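/- Let $W$ be a standard Brownian motion, $\sigma>0$ and $x_0\in\mathbb R$, and let $X$ be either the scaled Brownian motion $X_t=x_0+\sigma W_t$ or the Ornstein--Uhlenbeck process $dX_t=-\theta X_t\,dt+\sigma\,dW_t$, $X_0=x_0$ ($\theta\in\mathbb R$). For every $m\ge 0$ let $T=T_m>0$ and $x_T=x_{T,m}\in\mathbb R$; in the Ornstein--Uhlenbeck case assume in addition that $T=o(m)$ as $m\to\infty$. Let $\mathbb G_m$ be the law of the knots $(X_{k_1},\dots,X_{k_m})$, at the equidistant anchors $k_i=\frac{iT}{m+1}$, of the bridge of duration $T$ from $x_0$ to $x_T$, that is, their conditional law given $X_T=x_T$ (in the version that is weakly continuous in $x_T$, which exists). A blocking scheme consists of a partition of the anchors into nonempty classes $\mathcal A_1,\dots,\mathcal A_{k}$ and of probability vectors $q(1,\cdot),\dots,q(k,\cdot)$ on $\{1,\dots,k\}$. One Gibbs sweep performs successively, for $i=1,\dots,k$: draw $I\sim q(i,\cdot)$ and resample the knots with anchors in $\mathcal A_I$ from their conditional law under $\mathbb G_m$ given all the other knots. The scheme is * *checkerboard* if $k=2$, between any two anchors of one class there is an anchor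 of the other class, and $q(i,\cdot)=\delta_i$; * *lexicographic* if $k=m$, $\mathcal A_i=\{k_i\}$ and $q(i,\cdot)=\delta_i$; * *random* if $k=m$, $\mathcal A_i=\{k_i\}$ and $q(i,\cdot)$ is uniform on $\{1,\dots,m\}$. Let $P$ be the transition kernel on $\mathbb R^m$ of one sweep, which has stationary law $\pi=\mathbb G_m$. Its $\mathcal L^2$-convergence rate $\rho$ is the smallest number $\rho\ge 0$ such that for every square $\pi$-integrable $f$ and every $r>\rho$ there is $V_f>0$ with $\lVert P^nf-\pi(f)\rVert_{\mathcal L^2(\pi)}\le V_f r^n$ for all $n\geq 0$, and its relaxation time is $\mathcal T(m)=-1/\log\rho$ (read as $0$ if $\rho=0$). Suppose that for each $m\ge 2$ a checkerboard, a lexicographic or a random scheme is used. Then for all $m\ge2$ the rate $\rho$ exists (as a minimum) and $\rho<1$, and $$\mathcal T(m)=\mathcal O(m^2)\qquad\text{as } m\to\infty .$$ -/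

import Mathlib

open MeasureTheory ProbabilityTheory Filter Asymptotics
open scoped NNReal ENNReal Topology

namespace BlockedSampler

noncomputable section

/-! ### The diffusions -/

/-- `X` is the scaled Brownian motion `σ W`, started from `x₀`. -/
def IsScaledBrownian {Ω : Type*} [MeasurableSpace Ω] (P : Measure Ω)
    (W X : ℝ≥0 → Ω → ℝ) (σ x₀ : ℝ) : Prop :=
  ∀ᵐ ω ∂P, ∀ t : ℝ≥0, X t ω = x₀ + σ * W t ω

/-- `X` is a (continuous) solution of the Ornstein--Uhlenbeck equation
`dX_t = -θ X_t dt + σ dW_t`, `X_0 = x₀`. The noise being additive, the stochastic integral of the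
constant `σ` is `σ W_t`, and the equation is an integral equation for almost every path. -/
def IsOrnsteinUhlenbeck {Ω : Type*} [MeasurableSpace Ω] (P : Measure Ω)
    (W X : ℝ≥0 → Ω → ℝ) (θ σ x₀ : ℝ) : Prop :=
  ∀ᵐ ω ∂P, Continuous (fun t : ℝ≥0 => X t ω) ∧
    ∀ t : ℝ≥0, X t ω = x₀ - θ * (∫ s in (0 : ℝ)..(t : ℝ), X s.toNNReal ω) + σ * W t ω

/-! ### The bridge at the anchors -/

/-- The `m` equidistant anchors in `(0, T)`: the index `i = 0, …, m - 1` stands for the anchor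
`(i + 1) T / (m + 1)`. -/
def anchor (T : ℝ≥0) (m : ℕ) (i : Fin m) : ℝ≥0 :=
  ((i : ℕ) + 1 : ℝ≥0) * T / ((m : ℝ≥0) + 1)

/-- The laws `κ y` as elements of the space of probability measures with its weak topology. -/
def kernelLaw {m : ℕ} (κ : Kernel ℝ (Fin m → ℝ)) [IsMarkovKernel κ] (y : ℝ) :
    ProbabilityMeasure (Fin m → ℝ) :=
  ⟨κ y, inferInstance⟩

/-- `κ x_T` is the law of the knots `(X_{k_1}, …, X_{k_m})` of the bridge from `X_0` to `x_T` of
duration `T`: `κ` is the version of the conditional law of the knots given the end point `X_T` that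
depends (weakly) continuously on the end point. The starting point is not conditioned upon because
it is deterministic in all the processes considered. -/
structure IsBridgeKnotLaw {Ω : Type*} [MeasurableSpace Ω] (P : Measure Ω)
    (X : ℝ≥0 → Ω → ℝ) (T : ℝ≥0) (m : ℕ) (κ : Kernel ℝ (Fin m → ℝ)) [IsMarkovKernel κ] : Prop where
  hasCondDistrib : HasCondDistrib (fun ω (i : Fin m) => X (anchor T m i) ω) (X T) κ P
  continuous : Continuous (kernelLaw κ)

/-! ### Blocking schemes -/

/-- A blocking scheme for `m` anchors: a partition of the anchors into `k` nonempty classes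
(`cls j` is the class of the anchor `j`), and for each `i` the probability vector `q i` with which
the class to be updated in the `i`-th of the `k` steps of a sweep is selected. -/
structure BlockingScheme (m : ℕ) where
  k : ℕ
  cls : Fin m → Fin k
  surj : Function.Surjective cls
  q : Fin k → PMF (Fin k)

/-- Checkerboard scheme: two interlaced classes, updated one after the other. -/
def BlockingScheme.IsCheckerboard {m : ℕ} (S : BlockingScheme m) : Prop :=
  S.k = 2 ∧
  (∀ a c : Fin m, S.cls a = S.cls c → a < c → ∃ b, S.cls b ≠ S.cls a ∧ a < b ∧ b < c) ∧
  ∀ i, S.q i = PMF.pure i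

/-- Lexicographic scheme: the classes are the single anchors, updated in temporal order. -/
def BlockingScheme.IsLexicographic {m : ℕ} (S : BlockingScheme m) : Prop :=
  S.k = m ∧ (∀ j : Fin m, (S.cls j : ℕ) = (j : ℕ)) ∧ ∀ i, S.q i = PMF.pure i

/-- Random scheme: the classes are the single anchors, and each of the `m` steps of a sweep
updates a uniformly chosen one. -/
def BlockingScheme.IsRandom {m : ℕ} (S : BlockingScheme m) : Prop :=
  S.k = m ∧ (∀ j : Fin m, (S.cls j : ℕ) = (j : ℕ)) ∧ ∀ i j, S.q i j = (m : ℝ≥0∞)⁻¹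

/-! ### The Markov chain on the knots -/

/-- The σ-algebra on `ℝ^m` generated by the knots that do not belong to the class `i`. -/
abbrev BlockingScheme.others {m : ℕ} (S : BlockingScheme m) (i : Fin S.k) :
    MeasurableSpace (Fin m → ℝ) :=
  MeasurableSpace.comap (fun (x : Fin m → ℝ) (j : {j : Fin m // S.cls j ≠ i}) => x j) inferInstance

lemma BlockingScheme.others_le {m : ℕ} (S : BlockingScheme m) (i : Fin S.k) :
    S.others i ≤ (inferInstance : MeasurableSpace (Fin m → ℝ)) :=
  Measurable.comap_le (by fun_prop)

/-- Update of the class `i`: the new state is drawn from the conditional law under `π` of the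
vector of knots given the knots outside the class `i`; in particular the latter keep their
values. -/
def BlockingScheme.update {m : ℕ} (S : BlockingScheme m) (π : Measure (Fin m → ℝ))
    [IsFiniteMeasure π] (i : Fin S.k) : Kernel (Fin m → ℝ) (Fin m → ℝ) :=
  (condExpKernel π (S.others i)).comap id (measurable_id'' (S.others_le i))

/-- The `i`-th step of a sweep: a class `j` is selected with probability `q i j` and updated. -/
def BlockingScheme.step {m : ℕ} (S : BlockingScheme m) (π : Measure (Fin m → ℝ))
    [IsFiniteMeasure π] (i : Fin S.k) : Kernel (Fin m → ℝ) (Fin m → ℝ) where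
  toFun x := ∑ j, S.q i j • S.update π j x
  measurable' := by
    refine Measure.measurable_of_measurable_coe _ fun s hs => ?_
    simp only [Measure.coe_finsetSum, Measure.coe_smul, Finset.sum_apply, Pi.smul_apply,
      smul_eq_mul]
    exact Finset.measurable_sum _ fun j _ => ((S.update π j).measurable_coe hs).const_mul _

/-- Transition kernel of a full Gibbs sweep: the steps `0, 1, …, k - 1`, in this order. -/
def BlockingScheme.sweep {m : ℕ} (S : BlockingScheme m) (π : Measure (Fin m → ℝ))
    [IsFiniteMeasure π] : Kernel (Fin m → ℝ) (Fin m → ℝ) :=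
  (List.finRange S.k).foldl (fun κ i => S.step π i ∘ₖ κ) Kernel.id

/-! ### Convergence rate and relaxation time -/

/-- The numbers `ρ ≥ 0` such that for all square `π`-integrable `f` and all `r > ρ` there is `V > 0`
with `‖P^n f - π(f)‖_{L²(π)} ≤ V r^n` for all `n`. Powers of kernels are iterated transitions. -/
def l2Rates {E : Type*} [MeasurableSpace E] (π : Measure E) (K : Kernel E E) : Set ℝ :=
  {ρ | 0 ≤ ρ ∧ ∀ f : E → ℝ, MemLp f 2 π → ∀ r : ℝ, ρ < r → ∃ V : ℝ, 0 < V ∧ ∀ n : ℕ,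
    eLpNorm (fun x => (∫ y, f y ∂((K ^ n) x)) - ∫ y, f y ∂π) 2 π ≤ ENNReal.ofReal (V * r ^ n)}

/-- The `L²`-convergence rate: the minimum of the set `l2Rates`. -/
def l2ConvergenceRate {E : Type*} [MeasurableSpace E] (π : Measure E) (K : Kernel E E) : ℝ :=
  sInf (l2Rates π K)

/-- The relaxation time `-1 / log ρ` of the chain (equal to `0` if `ρ = 0`). -/
def relaxationTime {E : Type*} [MeasurableSpace E] (π : Measure E) (K : Kernel E E) : ℝ :=
  -1 / Real.log (l2ConvergenceRate π K)

end

end BlockedSampler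

open BlockedSampler

/-!
For a nearest-neighbour Gaussian law the conditional mean of one knot given all the others is, up to
a constant, `β` times the sum of its two neighbours. For the bridges considered here
`β = a / (1 + a ^ 2) ≤ 1 / 2`, where `a = exp (-θ T / (m + 1))`, whatever the drift and the duration
are. Scaled Brownian motion is the case `θ = 0`.

*The Gibbs sampler.* Resampling a block of knots that do not interact is the conditional expectation
given the other knots. It maps a function with coordinatewise Lipschitz constants `L` to one with
constants `L'`, where the constants of the block are handed over to the neighbouring coordinates
with weight `β` (`HasLinearCondMeans.condExp_ae_eq`, `CoordLipschitz.blockUpdate`). Dually, the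
weights `w` in `∑ w_j L_j` evolve by the mean dynamics of the sampler. For the concave weights
`w_j = (j + 1) (m - j)` one has `β (w_{j-1} + w_{j+1}) ≤ (1 - 4 / (m + 1) ^ 2) w_j`, and each of the
three schemes contracts `w` by at least `r = 1 - 2 / (m + 1) ^ 2` per sweep.

*From Lipschitz functions to `L²`.* The operator `P` of a sweep is a product of self-adjoint
operators, hence `P P*` is a sweep followed by the reversed one, and its iterates converge at rate
`r` on Lipschitz functions, which are dense. For a self-adjoint operator `A` the sequence `‖Aⁿ g‖`
is log-convex, so a rate on a dense set is a bound for the norm; thus `‖P P*‖ ≤ r` on centred functions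
and `‖P‖ ≤ √r` (`opNorm_sub_le_sqrt`). In particular `√r ≤ 1 - 1 / (m + 1) ^ 2` is one of the
admissible rates (`sqrt_mem_l2Rates`). The set of admissible rates contains its infimum by
definition, and `-1 / log ρ ≤ 1 / (1 - ρ)`.

*The bridge.* The innovations `X_{t + δ} - exp (-θ δ) X_t` are limits of exponentially weighted
sums of increments of `W`, and hence i.i.d. centred Gaussian variables
(`IsOrnsteinUhlenbeck.exists_hasLaw_innovations`). The observed process is thus a Gaussian
autoregression. Subtracting the regression on the end point yields the bridge in its continuous
version, and the covariances of the autoregression identify its conditional means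
(`IsAutoregression.hasLinearCondMeans_bridgeKernel`).
-/

namespace BlockedSampler

/-! ### Contraction of self-adjoint operators from decay on a dense set -/

section Hilbert

open scoped InnerProductSpace

variable {H : Type*} [NormedAddCommGroup H] [InnerProductSpace ℝ H]

/-- For a symmetric operator the sequence `‖Tⁿ g‖` is log-convex, so an exponential rate for a
single vector already bounds the first ratio `‖T g‖ / ‖g‖`. -/
lemma norm_apply_le_of_norm_pow_apply_le {T : H →L[ℝ] H} (hT : ∀ x y, ⟪T x, y⟫_ℝ = ⟪x, T y⟫_ℝ)
    {r : ℝ} (hr : 0 ≤ r) {g : H} {C : ℝ} (hC : ∀ n : ℕ, ‖(T ^ n) g‖ ≤ C * r ^ n) :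
    ‖T g‖ ≤ r * ‖g‖ := by
  rcases eq_or_ne g 0 with rfl | hg
  · simp
  have hg' : 0 < ‖g‖ := norm_pos_iff.2 hg
  set q := ‖T g‖ / ‖g‖ with hq
  have hq0 : 0 ≤ q := by positivity
  have hs : ∀ n, (T ^ (n + 1)) g = T ((T ^ n) g) := fun n => by rw [pow_succ']; rfl
  have hlog : ∀ n, ‖(T ^ (n + 1)) g‖ ^ 2 ≤ ‖(T ^ n) g‖ * ‖(T ^ (n + 2)) g‖ := fun n => by
    rw [← real_inner_self_eq_norm_sq, hs n, hT, ← hs, ← hs]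
    exact real_inner_le_norm _ _
  have hstep : ∀ n, q * ‖(T ^ n) g‖ ≤ ‖(T ^ (n + 1)) g‖ := by
    intro n
    induction n with
    | zero => simp [hq, hg'.ne']
    | succ n ih =>
      rcases (norm_nonneg ((T ^ n) g)).eq_or_lt with h0 | h0
      · rw [hs n, norm_eq_zero.1 h0.symm]; simp
      · have h2 := hlog n
        have : ‖(T ^ n) g‖ * (q * ‖(T ^ (n + 1)) g‖) ≤ ‖(T ^ n) g‖ * ‖(T ^ (n + 2)) g‖ := by
          calc _ = (q * ‖(T ^ n) g‖) * ‖(T ^ (n + 1)) g‖ := by ring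
            _ ≤ ‖(T ^ (n + 1)) g‖ * ‖(T ^ (n + 1)) g‖ := by gcongr
            _ ≤ _ := by rw [← sq]; exact h2
        exact le_of_mul_le_mul_left this h0
  have hpow : ∀ n, q ^ n * ‖g‖ ≤ ‖(T ^ n) g‖ := by
    intro n
    induction n with
    | zero => simp
    | succ n ih =>
      refine le_trans ?_ (hstep n)
      rw [pow_succ', mul_assoc]
      gcongr
  have hqr : q ≤ r := by
    by_contra! hlt
    have hqpos : 0 < q := hr.trans_lt hlt
    have hlim : Tendsto (fun n : ℕ => C * (r / q) ^ n) atTop (𝓝 (C * 0)) :=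
      (tendsto_pow_atTop_nhds_zero_of_lt_one (by positivity)
        ((div_lt_one hqpos).2 hlt)).const_mul C
    rw [mul_zero] at hlim
    refine hg'.not_ge (ge_of_tendsto' hlim fun n => ?_)
    rw [div_pow, ← mul_div_assoc, le_div_iff₀ (by positivity), mul_comm]
    exact (hpow n).trans (hC n)
  rwa [hq, div_le_iff₀ hg'] at hqr

lemma opNorm_le_of_dense_norm_pow_apply_le {T : H →L[ℝ] H}
    (hT : ∀ x y, ⟪T x, y⟫_ℝ = ⟪x, T y⟫_ℝ) {r : ℝ} (hr : 0 ≤ r) {D : Set H} (hD : Dense D)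
    (h : ∀ g ∈ D, ∃ C, ∀ n : ℕ, ‖(T ^ n) g‖ ≤ C * r ^ n) : ‖T‖ ≤ r := by
  refine T.opNorm_le_bound hr fun g => ?_
  have hcl : IsClosed {g : H | ‖T g‖ ≤ r * ‖g‖} :=
    isClosed_le (by fun_prop) (by fun_prop)
  exact hD.induction (P := fun g => ‖T g‖ ≤ r * ‖g‖) (fun g hg => by
    obtain ⟨C, hC⟩ := h g hg
    exact norm_apply_le_of_norm_pow_apply_le hT hr hC) hcl g

end Hilbert

/-- Subtracting an idempotent that absorbs `P` commutes with taking powers. -/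
lemma sub_pow_succ_of_absorb {R : Type*} [Ring R] {P Q : R} (h1 : P * Q = Q) (h2 : Q * P = Q)
    (h3 : Q * Q = Q) (n : ℕ) : (P - Q) ^ (n + 1) = P ^ (n + 1) - Q := by
  have h4 : ∀ n : ℕ, P ^ n * Q = Q := fun n => by
    induction n with
    | zero => simp
    | succ n ih => rw [pow_succ, mul_assoc, h1, ih]
  induction n with
  | zero => simp
  | succ n ih =>
    rw [pow_succ, ih, sub_mul, mul_sub, mul_sub, h4, h2, h3, ← pow_succ]
    abel

section Hilbert

open scoped InnerProductSpace

variable {H : Type*} [NormedAddCommGroup H] [InnerProductSpace ℝ H] [CompleteSpace H]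

/-- If the iterates of `P P*` converge to the projection `Q` at rate `r` on a dense set, then `P - Q`
has norm at most `√r`. Passing to `P P*` allows for a `P` that is not self-adjoint. -/
lemma opNorm_sub_le_sqrt {P Q : H →L[ℝ] H} (hQ : star Q = Q) (h1 : P * Q = Q) (h2 : Q * P = Q)
    (h3 : Q * Q = Q) {r : ℝ} (hr : 0 ≤ r) {D : Set H} (hD : Dense D)
    (h : ∀ g ∈ D, ∃ C, ∀ n : ℕ, ‖((P * star P) ^ n) g - Q g‖ ≤ C * r ^ n) : ‖P - Q‖ ≤ √r := by
  have h1' : Q * star P = Q := by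
    have := congrArg star h1
    rwa [star_mul, hQ] at this
  have h2' : star P * Q = Q := by
    have := congrArg star h2
    rwa [star_mul, hQ] at this
  have hmul : (P - Q) * star (P - Q) = P * star P - Q := by
    rw [star_sub, hQ, sub_mul, mul_sub, mul_sub, h1, h1', h3]
    abel
  have hsym : ∀ x y, ⟪(P * star P - Q) x, y⟫_ℝ = ⟪x, (P * star P - Q) y⟫_ℝ := by
    intro x y
    have : star (P * star P - Q) = P * star P - Q := by
      rw [star_sub, star_mul, star_star, hQ]
    rw [← ContinuousLinearMap.adjoint_inner_right, ← ContinuousLinearMap.star_eq_adjoint, this]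
  have hle : ‖P * star P - Q‖ ≤ r := by
    refine opNorm_le_of_dense_norm_pow_apply_le hsym hr hD fun g hg => ?_
    obtain ⟨C, hC⟩ := h g hg
    refine ⟨max C ‖g‖, fun n => ?_⟩
    rcases n with _ | n
    · simp
    · rw [sub_pow_succ_of_absorb (by rw [mul_assoc, h2', h1]) (by rw [← mul_assoc, h2, h1']) h3]
      refine (hC (n + 1)).trans ?_
      gcongr
      exact le_max_left _ _
  rw [← hmul] at hle
  have hnorm := CStarRing.norm_self_mul_star (x := P - Q)
  exact Real.le_sqrt_of_sq_le (by rw [sq]; exact hnorm.symm.le.trans hle)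

end Hilbert

/-! ### Conditional expectations and Markov kernels as operators on `L²` -/

section CondExpOperator

open scoped InnerProductSpace

variable {E : Type*} {m m' mE : MeasurableSpace E} (π : Measure E)

/-- Conditional expectation given `m` as an operator on `L²(π)`. -/
noncomputable def condExpOp (hm : m ≤ mE) : Lp ℝ 2 π →L[ℝ] Lp ℝ 2 π :=
  (lpMeas ℝ ℝ m 2 π).subtypeL ∘L condExpL2 ℝ ℝ hm

lemma condExpOp_ae_eq [IsFiniteMeasure π] (hm : m ≤ mE) (g : Lp ℝ 2 π) :
    condExpOp π hm g =ᵐ[π] π[g | m] := by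
  have h := (Lp.memLp g).condExpL2_ae_eq_condExp (𝕜 := ℝ) hm
  rwa [Lp.toLp_coeFn] at h

lemma star_condExpOp (hm : m ≤ mE) : star (condExpOp π hm) = condExpOp π hm := by
  rw [ContinuousLinearMap.star_eq_adjoint, eq_comm, ContinuousLinearMap.eq_adjoint_iff]
  intro x y
  exact inner_condExpL2_left_eq_right hm

lemma condExpOp_mul_of_le [IsFiniteMeasure π] (hm : m ≤ mE) (hm' : m' ≤ mE) (h : m ≤ m') :
    condExpOp π hm * condExpOp π hm' = condExpOp π hm := by
  ext1 g
  refine Lp.ext ?_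
  have h1 : π[condExpOp π hm' g | m] =ᵐ[π] π[π[g | m'] | m] :=
    condExp_congr_ae (condExpOp_ae_eq π hm' g)
  exact (condExpOp_ae_eq π hm _).trans
    ((h1.trans (condExp_condExp_of_le h hm')).trans (condExpOp_ae_eq π hm g).symm)

lemma condExpOp_mul_of_ge [IsFiniteMeasure π] (hm : m ≤ mE) (hm' : m' ≤ mE) (h : m ≤ m') :
    condExpOp π hm' * condExpOp π hm = condExpOp π hm := by
  have := congrArg star (condExpOp_mul_of_le π hm hm' h)
  rwa [star_mul, star_condExpOp, star_condExpOp] at this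

end CondExpOperator

section Represents

variable {E : Type*} [MeasurableSpace E] {π : Measure E}

/-- The Markov kernel `K` leaves `π` invariant and acts on `L²(π)` as the operator `A`. -/
structure Represents (π : Measure E) (K : Kernel E E) (A : Lp ℝ 2 π →L[ℝ] Lp ℝ 2 π) : Prop where
  invariant : K ∘ₘ π = π
  ae_eq : ∀ g : Lp ℝ 2 π, A g =ᵐ[π] fun x => ∫ y, g y ∂K x

lemma ae_kernel_of_ae {K : Kernel E E} (h : K ∘ₘ π = π) {p : E → Prop} (hp : ∀ᵐ y ∂π, p y) :
    ∀ᵐ x ∂π, ∀ᵐ y ∂K x, p y := by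
  rw [← h] at hp
  exact Measure.ae_ae_of_ae_comp hp

lemma Represents.id : Represents π Kernel.id 1 where
  invariant := Measure.id_comp
  ae_eq g := by
    refine ae_of_all _ fun x => ?_
    change g x = ∫ y, g y ∂(Kernel.id x)
    rw [Kernel.id_apply, integral_dirac' _ _ (Lp.stronglyMeasurable g)]

lemma Represents.comp [IsFiniteMeasure π] {K K' : Kernel E E} [IsSFiniteKernel K]
    [IsSFiniteKernel K']
    {A A' : Lp ℝ 2 π →L[ℝ] Lp ℝ 2 π}
    (h : Represents π K A) (h' : Represents π K' A') : Represents π (K' ∘ₖ K) (A * A') where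
  invariant := by rw [← Measure.comp_assoc, h.invariant, h'.invariant]
  ae_eq g := by
    have hinv : (K' ∘ₖ K) ∘ₘ π = π := by rw [← Measure.comp_assoc, h.invariant, h'.invariant]
    have hint : Integrable g ((K' ∘ₖ K) ∘ₘ π) := by
      rw [hinv]; exact (Lp.memLp g).integrable one_le_two
    have h1 := ((Measure.integrable_comp_iff hint.1).1 hint).1
    filter_upwards [h.ae_eq (A' g), ae_kernel_of_ae h.invariant (h'.ae_eq g), h1] with x hx1 hx2 hx3
    rw [Kernel.integral_comp hx3, ← integral_congr_ae hx2]
    exact hx1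

lemma Represents.pow [IsFiniteMeasure π] {K : Kernel E E} [IsMarkovKernel K]
    {A : Lp ℝ 2 π →L[ℝ] Lp ℝ 2 π}
    (h : Represents π K A) (n : ℕ) : Represents π (K ^ n) (A ^ n) := by
  have hM : ∀ n : ℕ, IsMarkovKernel (K ^ n) := fun n => by
    induction n with
    | zero => rw [pow_zero]; exact (inferInstance : IsMarkovKernel (Kernel.id : Kernel E E))
    | succ n ih =>
      rw [pow_succ]; exact (inferInstance : IsMarkovKernel ((K ^ n) ∘ₖ K))
  induction n with
  | zero => rw [pow_zero, pow_zero]; exact Represents.id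
  | succ n ih =>
    have := hM n
    rw [pow_succ K, pow_succ' A]
    exact h.comp ih

end Represents

section Sweep

variable {m : ℕ} (S : BlockingScheme m) (π : Measure (Fin m → ℝ)) [IsFiniteMeasure π]

lemma BlockingScheme.sum_q {m : ℕ} (S : BlockingScheme m) (i : Fin S.k) : ∑ j, S.q i j = 1 := by
  rw [← (S.q i).tsum_coe, tsum_eq_sum fun j hj => absurd (Finset.mem_univ j) hj]

instance (i : Fin S.k) : IsMarkovKernel (S.update π i) := by
  unfold BlockingScheme.update; infer_instance

instance (i : Fin S.k) : IsMarkovKernel (S.step π i) where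
  isProbabilityMeasure x := ⟨by
    change (∑ j, S.q i j • S.update π j x) Set.univ = 1
    simp only [Measure.coe_finsetSum, Measure.coe_smul, Finset.sum_apply, Pi.smul_apply,
      smul_eq_mul, measure_univ, mul_one]
    exact S.sum_q i⟩

/-- The `L²(π)`-operator of the `i`-th step of a sweep. -/
noncomputable def BlockingScheme.stepOp (i : Fin S.k) : Lp ℝ 2 π →L[ℝ] Lp ℝ 2 π :=
  ∑ j, (S.q i j).toReal • condExpOp π (S.others_le j)

lemma BlockingScheme.update_invariant (j : Fin S.k) : S.update π j ∘ₘ π = π := by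
  have h := condExpKernel_comp_trim (μ := π) (S.others_le j)
  ext s hs
  conv_rhs => rw [← h]
  rw [Measure.bind_apply hs (Kernel.aemeasurable _),
    Measure.bind_apply hs (Kernel.aemeasurable _), lintegral_trim]
  · rfl
  · exact Kernel.measurable_coe _ hs

lemma BlockingScheme.represents_step (i : Fin S.k) :
    Represents π (S.step π i) (S.stepOp π i) where
  invariant := by
    ext s hs
    have hj : ∀ j, ∫⁻ x, S.update π j x s ∂π = π s := fun j => by
      conv_rhs => rw [← S.update_invariant π j]
      rw [Measure.bind_apply hs (Kernel.aemeasurable _)]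
    rw [Measure.bind_apply hs (Kernel.aemeasurable _)]
    calc ∫⁻ x, S.step π i x s ∂π = ∫⁻ x, ∑ j, S.q i j * S.update π j x s ∂π := by
          refine lintegral_congr fun x => ?_
          change (∑ j, S.q i j • S.update π j x) s = _
          simp
      _ = ∑ j, S.q i j * π s := by
          rw [lintegral_finsetSum]
          · refine Finset.sum_congr rfl fun j _ => ?_
            rw [lintegral_const_mul _ (Kernel.measurable_coe _ hs), hj]
          · exact fun j _ => (Kernel.measurable_coe _ hs).const_mul _
      _ = π s := by
          rw [← Finset.sum_mul, S.sum_q, one_mul]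
  ae_eq g := by
    have hg : Integrable g π := (Lp.memLp g).integrable one_le_two
    have h1 : ∀ j, ∀ᵐ x ∂π, Integrable g (S.update π j x) := fun j => by
      have : Integrable g (S.update π j ∘ₘ π) := by rwa [S.update_invariant]
      exact ((Measure.integrable_comp_iff this.1).1 this).1
    have h2 : ∀ j, condExpOp π (S.others_le j) g =ᵐ[π] fun x => ∫ y, g y ∂S.update π j x :=
      fun j => (condExpOp_ae_eq π _ g).trans
        (condExp_ae_eq_integral_condExpKernel (S.others_le j) hg)
    have h3 : S.stepOp π i g =ᵐ[π]
        fun x => ∑ j, (S.q i j).toReal * condExpOp π (S.others_le j) g x := by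
      have : S.stepOp π i g = ∑ j, (S.q i j).toReal • condExpOp π (S.others_le j) g := by
        simp [BlockingScheme.stepOp]
      rw [this]
      refine (Lp.coeFn_finsetSum _ _).trans ?_
      have h4 : ∀ᵐ x ∂π, ∀ j, ((S.q i j).toReal • condExpOp π (S.others_le j) g : Lp ℝ 2 π) x =
          (S.q i j).toReal * condExpOp π (S.others_le j) g x :=
        ae_all_iff.2 fun j => Lp.coeFn_smul _ _
      filter_upwards [h4] with x hx
      simp [hx]
    filter_upwards [h3, ae_all_iff.2 h1, ae_all_iff.2 h2] with x hx1 hx2 hx3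
    rw [hx1]
    change _ = ∫ y, g y ∂(∑ j, S.q i j • S.update π j x)
    rw [integral_finsetSum_measure]
    · refine Finset.sum_congr rfl fun j _ => ?_
      rw [integral_smul_measure, hx3, smul_eq_mul]
    · exact fun j _ => (hx2 j).smul_measure ((S.q i).apply_ne_top j)

/-- The `L²(π)`-operator of a sweep. The first step is the leftmost factor, because it is the last
one to act on functions. -/
noncomputable def BlockingScheme.sweepOp : Lp ℝ 2 π →L[ℝ] Lp ℝ 2 π :=
  ((List.finRange S.k).map (S.stepOp π)).prod

lemma BlockingScheme.represents_sweep :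
    IsMarkovKernel (S.sweep π) ∧ Represents π (S.sweep π) (S.sweepOp π) := by
  have key : ∀ (l : List (Fin S.k)) (K : Kernel (Fin m → ℝ) (Fin m → ℝ))
      (A : Lp ℝ 2 π →L[ℝ] Lp ℝ 2 π), IsMarkovKernel K → Represents π K A →
      IsMarkovKernel (l.foldl (fun κ i => S.step π i ∘ₖ κ) K) ∧
      Represents π (l.foldl (fun κ i => S.step π i ∘ₖ κ) K) (A * (l.map (S.stepOp π)).prod) := by
    intro l
    induction l with
    | nil => intro K A hK hA; simpa using ⟨hK, hA⟩
    | cons i l ih =>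
      intro K A hK hA
      have := ih (S.step π i ∘ₖ K) (A * S.stepOp π i) inferInstance
        (hA.comp (S.represents_step π i))
      simpa [mul_assoc] using this
  have := key (List.finRange S.k) Kernel.id 1 inferInstance Represents.id
  rw [one_mul] at this
  exact this

end Sweep

section Rates

variable {E : Type*} [MeasurableSpace E] {π : Measure E}

/-- A bound on the norm of the centred transition operator bounds the `L²`-rate. -/
lemma mem_l2Rates_of_opNorm_le [IsProbabilityMeasure π] {K : Kernel E E} [IsMarkovKernel K]
    {A : Lp ℝ 2 π →L[ℝ] Lp ℝ 2 π} (hA : Represents π K A)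
    (h1 : A * condExpOp π bot_le = condExpOp π bot_le)
    (h2 : condExpOp π bot_le * A = condExpOp π bot_le) {s : ℝ} (hs : 0 ≤ s)
    (h : ‖A - condExpOp π bot_le‖ ≤ s) : s ∈ l2Rates π K := by
  set Q : Lp ℝ 2 π →L[ℝ] Lp ℝ 2 π := condExpOp π bot_le with hQ
  have h3 : Q * Q = Q := condExpOp_mul_of_le π _ _ le_rfl
  refine ⟨hs, fun f hf r hr => ?_⟩
  set g := hf.toLp f with hg
  refine ⟨‖g - Q g‖ + 1 + ‖g‖, by positivity, fun n => ?_⟩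
  have hbound : ‖(A ^ n) g - Q g‖ ≤ (‖g - Q g‖ + 1 + ‖g‖) * r ^ n := by
    have hr0 : 0 ≤ r := hs.trans hr.le
    rcases n with _ | n
    · simp only [pow_zero, mul_one]
      change ‖g - Q g‖ ≤ _
      linarith [norm_nonneg g]
    · have : (A ^ (n + 1)) g - Q g = ((A - Q) ^ (n + 1)) g := by
        rw [sub_pow_succ_of_absorb h1 h2 h3]; rfl
      rw [this]
      calc ‖((A - Q) ^ (n + 1)) g‖ ≤ ‖(A - Q) ^ (n + 1)‖ * ‖g‖ := ContinuousLinearMap.le_opNorm _ _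
        _ ≤ s ^ (n + 1) * ‖g‖ := by
            gcongr
            exact (norm_pow_le' _ n.succ_pos).trans (by gcongr)
        _ ≤ r ^ (n + 1) * (‖g - Q g‖ + 1 + ‖g‖) := by
            gcongr
            linarith [norm_nonneg (g - Q g)]
        _ = _ := mul_comm _ _
  have hfg : f =ᵐ[π] g := hf.coeFn_toLp.symm
  have hae : (fun x => (∫ y, f y ∂((K ^ n) x)) - ∫ y, f y ∂π) =ᵐ[π] ((A ^ n) g - Q g : Lp ℝ 2 π) := by
    have hn := hA.pow n
    have hQg : Q g =ᵐ[π] fun _ => ∫ y, f y ∂π := by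
      refine (condExpOp_ae_eq π _ g).trans ?_
      rw [condExp_bot, integral_congr_ae hfg]
    filter_upwards [Lp.coeFn_sub ((A ^ n) g) (Q g), hn.ae_eq g, hQg,
      ae_kernel_of_ae hn.invariant hfg] with x hx1 hx2 hx3 hx4
    rw [hx1, Pi.sub_apply, hx2, hx3, integral_congr_ae hx4]
  rw [eLpNorm_congr_ae hae, ← ENNReal.ofReal_toReal (Lp.eLpNorm_ne_top _)]
  exact ENNReal.ofReal_le_ofReal hbound

lemma isLeast_l2ConvergenceRate {K : Kernel E E} (h : (l2Rates π K).Nonempty) :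
    IsLeast (l2Rates π K) (l2ConvergenceRate π K) := by
  have hbdd : BddBelow (l2Rates π K) := ⟨0, fun ρ hρ => hρ.1⟩
  refine ⟨⟨le_csInf h fun ρ hρ => hρ.1, fun f hf r hr => ?_⟩, fun ρ hρ => csInf_le hbdd hρ⟩
  obtain ⟨ρ, hρ, hlt⟩ := exists_lt_of_csInf_lt h hr
  exact hρ.2 f hf r hlt

lemma relaxationTime_le_of_mem {K : Kernel E E} {s : ℝ} (h : s ∈ l2Rates π K) (hs : s < 1) :
    |relaxationTime π K| ≤ (1 - s)⁻¹ := by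
  have hL := isLeast_l2ConvergenceRate ⟨s, h⟩
  set ρ := l2ConvergenceRate π K with hρ
  have hle : ρ ≤ s := hL.2 h
  have h0 : 0 ≤ ρ := hL.1.1
  rw [relaxationTime, ← hρ]
  rcases h0.eq_or_lt with h0 | h0
  · rw [← h0]; simp; linarith
  · have hlog : Real.log ρ ≤ ρ - 1 := Real.log_le_sub_one_of_pos h0
    have hneg : Real.log ρ < 0 := by linarith
    rw [abs_of_nonneg (div_nonneg_of_nonpos (by norm_num) hneg.le), ← neg_div_neg_eq, neg_neg,
      one_div]
    exact inv_anti₀ (by linarith) (by linarith)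

end Rates

/-! ### Conditional laws of a Gaussian vector with linear conditional means -/

section Block

variable {ι : Type*} [Fintype ι]

/-- The vector of the differences `x_j - (B x)_j`. -/
def residual (B : Matrix ι ι ℝ) (x : ι → ℝ) : ι → ℝ := fun j => x j - ∑ l, B j l * x l

/-- The vector `x`, with the coordinates satisfying `p` replaced by `B x + e`. -/
def blockUpdate (B : Matrix ι ι ℝ) (p : ι → Prop) [DecidablePred p] (x e : ι → ℝ) : ι → ℝ :=
  fun j => if p j then (∑ l, B j l * x l) + e j else x j

/-- The Gaussian law `π` has `(B x)_i`, up to an additive constant, as conditional mean of its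
`i`-th coordinate given the other ones: the residual at `i` is uncorrelated with the other
coordinates. -/
structure HasLinearCondMeans (π : Measure (ι → ℝ)) (B : Matrix ι ι ℝ) : Prop where
  gaussian : HasGaussianLaw (fun x : ι → ℝ => x) π
  uncorrelated : ∀ i l, l ≠ i → cov[fun x => residual B x i, fun x => x l; π] = 0

@[fun_prop]
lemma measurable_residual (B : Matrix ι ι ℝ) : Measurable (residual B) := by
  unfold residual; fun_prop

lemma continuous_blockUpdate (B : Matrix ι ι ℝ) (p : ι → Prop) [DecidablePred p] (x : ι → ℝ) :
    Continuous (blockUpdate B p x) := by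
  refine continuous_pi fun j => ?_
  unfold blockUpdate
  split_ifs <;> fun_prop

/-- Conditional expectation of a function of two independent variables given the first one. -/
lemma condExp_prod_ae_eq_of_indepFun {Ω α β : Type*} [MeasurableSpace Ω] [mα : MeasurableSpace α]
    [MeasurableSpace β] [StandardBorelSpace β] [Nonempty β] {μ : Measure Ω} [IsProbabilityMeasure μ]
    {X : Ω → α} {Y : Ω → β} (hX : Measurable X) (hY : Measurable Y) (hXY : IndepFun X Y μ)
    {f : α × β → ℝ} (hf : StronglyMeasurable f) (hint : Integrable (fun a => f (X a, Y a)) μ) :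
    μ[fun a => f (X a, Y a) | mα.comap X] =ᵐ[μ] fun a => ∫ y, f (X a, y) ∂(μ.map Y) := by
  have : IsProbabilityMeasure (μ.map Y) := Measure.isProbabilityMeasure_map hY.aemeasurable
  have h1 : condDistrib Y X μ =ᵐ[μ.map X] Kernel.const α (μ.map Y) := by
    refine condDistrib_ae_eq_of_measure_eq_compProd X hY.aemeasurable ?_
    rw [Measure.compProd_const]
    exact (indepFun_iff_map_prod_eq_prod_map_map hX.aemeasurable hY.aemeasurable).1 hXY
  refine (condExp_prod_ae_eq_integral_condDistrib hX hY.aemeasurable hf hint).trans ?_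
  filter_upwards [ae_of_ae_map hX.aemeasurable h1] with a ha
  rw [ha, Kernel.const_apply]

/-- Resampling a block of coordinates that do not interact with each other: given the other
coordinates, the residuals in the block keep their unconditional law. -/
lemma HasLinearCondMeans.condExp_ae_eq {π : Measure (ι → ℝ)} {B : Matrix ι ι ℝ}
    (h : HasLinearCondMeans π B) (p : ι → Prop) [DecidablePred p]
    (hp : ∀ j l, p j → p l → B j l = 0) {f : (ι → ℝ) → ℝ} (hf : Continuous f)
    (hint : Integrable f π) :
    π[f | MeasurableSpace.comap (fun (x : ι → ℝ) (j : {j // ¬ p j}) => x j) inferInstance]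
      =ᵐ[π] fun x => ∫ e, f (blockUpdate B p x e) ∂(π.map (residual B)) := by
  have hprob : IsProbabilityMeasure π := h.gaussian.isProbabilityMeasure
  set X : (ι → ℝ) → ({j // ¬ p j} → ℝ) := fun x j => x j with hX
  set Y : (ι → ℝ) → ({j // p j} → ℝ) := fun x j => residual B x j with hY
  have hXm : Measurable X := by fun_prop
  have hYm : Measurable Y := by unfold Y residual; fun_prop
  have hindep : IndepFun X Y π := by
    refine HasGaussianLaw.indepFun_of_covariance_eval
      (X := fun (i : {j // ¬ p j}) (x : ι → ℝ) => x i)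
      (Y := fun (j : {j // p j}) (x : ι → ℝ) => residual B x j) ?_ fun i j => ?_
    · exact h.gaussian.map_fun
        ((ContinuousLinearMap.pi fun i : {j // ¬ p j} =>
            ContinuousLinearMap.proj (R := ℝ) (φ := fun _ => ℝ) (i : ι)).prod
          (ContinuousLinearMap.pi fun j : {j // p j} =>
            ContinuousLinearMap.proj (R := ℝ) (φ := fun _ => ℝ) (j : ι) -
              ∑ l, B j l • ContinuousLinearMap.proj (R := ℝ) (φ := fun _ => ℝ) l)) |>.congr
        (ae_of_all _ fun x => by
          refine Prod.ext rfl (funext fun j => ?_)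
          simp [residual])
    · rw [covariance_comm]
      exact h.uncorrelated j i fun hij => i.2 (hij ▸ j.2)
  -- `f` as a function of the coordinates outside the block and of the residuals inside
  set F : ({j // ¬ p j} → ℝ) × ({j // p j} → ℝ) → ℝ := fun z => f fun j =>
    if hj : p j then (∑ l, B j l * if hl : p l then 0 else z.1 ⟨l, hl⟩) + z.2 ⟨j, hj⟩
    else z.1 ⟨j, hj⟩ with hF
  have hFc : Continuous F := by
    refine hf.comp (continuous_pi fun j => ?_)
    by_cases hj : p j
    · simp only [hj, dite_true]
      refine Continuous.add (continuous_finsetSum _ fun l _ => ?_) (by fun_prop)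
      by_cases hl : p l
      · simp only [hl, dite_true]; fun_prop
      · simp only [hl, dite_false]; fun_prop
    · simp only [hj, dite_false]; fun_prop
  have hsum : ∀ j, p j → ∀ x : ι → ℝ,
      (∑ l, B j l * if hl : p l then 0 else X x ⟨l, hl⟩) = ∑ l, B j l * x l := by
    intro j hj x
    refine Finset.sum_congr rfl fun l _ => ?_
    by_cases hl : p l
    · simp [hp j l hj hl]
    · simp [hl, hX]
  have hFe : ∀ x e, F (X x, fun j => e j) = f (blockUpdate B p x e) := by
    intro x e
    refine congrArg f (funext fun j => ?_)
    by_cases hj : p j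
    · simp only [hj, dite_true, blockUpdate, if_true, hsum j hj]
    · simp [hj, blockUpdate, hX]
  have hFx : ∀ x, F (X x, Y x) = f x := by
    intro x
    rw [show Y x = fun j : {j // p j} => residual B x j from rfl, hFe]
    refine congrArg f (funext fun j => ?_)
    simp [blockUpdate, residual]
  have key := condExp_prod_ae_eq_of_indepFun hXm hYm hindep hFc.stronglyMeasurable
    (by simpa only [hFx] using hint)
  simp only [hFx] at key
  refine key.trans (ae_of_all _ fun x => ?_)
  have hmap : π.map Y = (π.map (residual B)).map fun e (j : {j // p j}) => e j := by
    rw [Measure.map_map (by fun_prop) (by fun_prop)]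
    rfl
  change ∫ y, F (X x, y) ∂(π.map Y) = _
  have hrestr : Measurable fun (e : ι → ℝ) (j : {j // p j}) => e j := by fun_prop
  rw [hmap, integral_map hrestr.aemeasurable]
  · simp only [hFe]
  · exact (hFc.comp (by fun_prop)).aestronglyMeasurable

end Block

/-! ### Coordinatewise Lipschitz constants -/

section Lipschitz

variable {ι : Type*} [Fintype ι]

/-- `f` is bounded, and Lipschitz with constant `L j` in the `j`-th coordinate. -/
structure CoordLipschitz (f : (ι → ℝ) → ℝ) (L : ι → ℝ) : Prop where
  bounded : ∃ M, ∀ x, |f x| ≤ M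
  abs_sub_le : ∀ x y, |f x - f y| ≤ ∑ j, L j * |x j - y j|

lemma CoordLipschitz.continuous {f : (ι → ℝ) → ℝ} {L : ι → ℝ} (h : CoordLipschitz f L) :
    Continuous f := by
  refine continuous_iff_continuousAt.2 fun x => tendsto_iff_dist_tendsto_zero.2 ?_
  refine squeeze_zero (fun _ => dist_nonneg) (fun y => h.abs_sub_le y x) ?_
  have : Continuous fun y : ι → ℝ => ∑ j, L j * |y j - x j| := by fun_prop
  simpa using this.tendsto x

lemma CoordLipschitz.integrable {f : (ι → ℝ) → ℝ} {L : ι → ℝ} (h : CoordLipschitz f L)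
    (π : Measure (ι → ℝ)) [IsFiniteMeasure π] : Integrable f π := by
  obtain ⟨M, hM⟩ := h.bounded
  exact Integrable.of_bound h.continuous.aestronglyMeasurable M (ae_of_all _ hM)

/-- The Lipschitz constants after resampling the block `p`: the constants of the coordinates in the
block are passed on to the coordinates on which their conditional means depend. -/
def blockLip (B : Matrix ι ι ℝ) (p : ι → Prop) [DecidablePred p] (L : ι → ℝ) : ι → ℝ :=
  fun l => (if p l then 0 else L l) + ∑ j, if p j then L j * B j l else 0

/-- The mean dynamics of resampling the block `p`, which is dual to `blockLip`. -/
def blockMean (B : Matrix ι ι ℝ) (p : ι → Prop) [DecidablePred p] (u : ι → ℝ) : ι → ℝ :=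
  fun l => if p l then ∑ j, B l j * u j else u l

lemma sum_mul_blockLip (B : Matrix ι ι ℝ) (p : ι → Prop) [DecidablePred p] (L u : ι → ℝ) :
    ∑ l, u l * blockLip B p L l = ∑ l, blockMean B p u l * L l := by
  have h1 : ∑ l, u l * ∑ j, (if p j then L j * B j l else 0) =
      ∑ j, if p j then (∑ l, B j l * u l) * L j else 0 := by
    simp_rw [Finset.mul_sum]
    rw [Finset.sum_comm]
    refine Finset.sum_congr rfl fun j _ => ?_
    split_ifs
    · rw [Finset.sum_mul]
      exact Finset.sum_congr rfl fun l _ => by ring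
    · simp
  simp only [blockLip, mul_add, Finset.sum_add_distrib, h1, blockMean]
  rw [← Finset.sum_add_distrib]
  refine Finset.sum_congr rfl fun l _ => ?_
  split_ifs <;> ring

lemma blockLip_nonneg {B : Matrix ι ι ℝ} (hB : ∀ i j, 0 ≤ B i j) (p : ι → Prop) [DecidablePred p]
    {L : ι → ℝ} (hL : ∀ j, 0 ≤ L j) (l : ι) : 0 ≤ blockLip B p L l := by
  unfold blockLip
  refine add_nonneg (by split_ifs <;> simp [hL]) (Finset.sum_nonneg fun j _ => ?_)
  split_ifs
  · exact mul_nonneg (hL j) (hB j l)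
  · exact le_rfl

lemma CoordLipschitz.blockUpdate {f : (ι → ℝ) → ℝ} {L : ι → ℝ} (h : CoordLipschitz f L)
    (hL : ∀ j, 0 ≤ L j) {B : Matrix ι ι ℝ} (hB : ∀ i j, 0 ≤ B i j) (p : ι → Prop) [DecidablePred p]
    (ν : Measure (ι → ℝ)) [IsProbabilityMeasure ν] :
    CoordLipschitz (fun x => ∫ e, f (blockUpdate B p x e) ∂ν) (blockLip B p L) := by
  obtain ⟨M, hM⟩ := h.bounded
  have hint : ∀ x, Integrable (fun e => f (BlockedSampler.blockUpdate B p x e)) ν := fun x =>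
    Integrable.of_bound (h.continuous.comp (continuous_blockUpdate B p x)).aestronglyMeasurable M
      (ae_of_all _ fun e => hM _)
  refine ⟨⟨M, fun x => ?_⟩, fun x y => ?_⟩
  · simpa using norm_integral_le_of_norm_le_const (μ := ν)
      (f := fun e => f (BlockedSampler.blockUpdate B p x e)) (ae_of_all _ fun e => hM _)
  · have hpt : ∀ e, |f (BlockedSampler.blockUpdate B p x e) - f (BlockedSampler.blockUpdate B p y e)|
        ≤ ∑ l, blockLip B p L l * |x l - y l| := by
      intro e
      refine (h.abs_sub_le _ _).trans ?_
      calc ∑ j, L j * |BlockedSampler.blockUpdate B p x e j - BlockedSampler.blockUpdate B p y e j|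
          ≤ ∑ j, blockMean B p (fun l => |x l - y l|) j * L j := by
            refine Finset.sum_le_sum fun j _ => ?_
            rw [mul_comm]
            refine mul_le_mul_of_nonneg_right ?_ (hL j)
            unfold BlockedSampler.blockUpdate blockMean
            split_ifs
            · rw [add_sub_add_right_eq_sub, ← Finset.sum_sub_distrib]
              refine (Finset.abs_sum_le_sum_abs _ _).trans (Finset.sum_le_sum fun l _ => ?_)
              rw [← mul_sub, abs_mul, abs_of_nonneg (hB j l)]
            · exact le_rfl
        _ = ∑ l, |x l - y l| * blockLip B p L l := (sum_mul_blockLip B p L _).symm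
        _ = _ := Finset.sum_congr rfl fun l _ => mul_comm _ _
    rw [← integral_sub (hint x) (hint y)]
    simpa using norm_integral_le_of_norm_le_const (μ := ν)
      (f := fun e => f (BlockedSampler.blockUpdate B p x e) - f (BlockedSampler.blockUpdate B p y e))
      (ae_of_all _ hpt)

/-- The class `g` in `L²(π)` has a representative with coordinatewise Lipschitz constants `L`. -/
def HasLipConst (π : Measure (ι → ℝ)) (g : Lp ℝ 2 π) (L : ι → ℝ) : Prop :=
  (∀ j, 0 ≤ L j) ∧ ∃ f, CoordLipschitz f L ∧ g =ᵐ[π] f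

lemma HasLinearCondMeans.hasLipConst_condExpOp {π : Measure (ι → ℝ)} [IsFiniteMeasure π]
    {B : Matrix ι ι ℝ} (h : HasLinearCondMeans π B) (hB : ∀ i j, 0 ≤ B i j)
    (p : ι → Prop) [DecidablePred p] (hp : ∀ j l, p j → p l → B j l = 0)
    (hm : MeasurableSpace.comap (fun (x : ι → ℝ) (j : {j // ¬ p j}) => x j) inferInstance ≤
      (inferInstance : MeasurableSpace (ι → ℝ)))
    {g : Lp ℝ 2 π} {L : ι → ℝ} (hg : HasLipConst π g L) :
    HasLipConst π (condExpOp π hm g) (blockLip B p L) := by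
  have hprob : IsProbabilityMeasure π := h.gaussian.isProbabilityMeasure
  have : IsProbabilityMeasure (π.map (residual B)) :=
    Measure.isProbabilityMeasure_map (measurable_residual B).aemeasurable
  obtain ⟨hL, f, hf, hgf⟩ := hg
  refine ⟨blockLip_nonneg hB p hL, _, hf.blockUpdate hL hB p (π.map (residual B)), ?_⟩
  exact (condExpOp_ae_eq π hm g).trans ((condExp_congr_ae hgf).trans
    (h.condExp_ae_eq p hp hf.continuous (hf.integrable π)))

lemma hasLipConst_sum {π : Measure (ι → ℝ)} {κ : Type*} [Fintype κ] {c : κ → ℝ}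
    (hc : ∀ k, 0 ≤ c k) {g : κ → Lp ℝ 2 π} {L : κ → ι → ℝ} (h : ∀ k, HasLipConst π (g k) (L k)) :
    HasLipConst π (∑ k, c k • g k) (fun j => ∑ k, c k * L k j) := by
  choose hL f hf hgf using h
  refine ⟨fun j => Finset.sum_nonneg fun k _ => mul_nonneg (hc k) (hL k j),
    fun x => ∑ k, c k * f k x, ⟨?_, fun x y => ?_⟩, ?_⟩
  · choose M hM using fun k => (hf k).bounded
    refine ⟨∑ k, c k * M k, fun x => (Finset.abs_sum_le_sum_abs _ _).trans
      (Finset.sum_le_sum fun k _ => ?_)⟩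
    rw [abs_mul, abs_of_nonneg (hc k)]
    exact mul_le_mul_of_nonneg_left (hM k x) (hc k)
  · rw [← Finset.sum_sub_distrib]
    refine (Finset.abs_sum_le_sum_abs _ _).trans ?_
    simp_rw [Finset.sum_mul]
    rw [Finset.sum_comm]
    refine Finset.sum_le_sum fun k _ => ?_
    rw [← mul_sub, abs_mul, abs_of_nonneg (hc k)]
    refine (mul_le_mul_of_nonneg_left ((hf k).abs_sub_le x y) (hc k)).trans_eq ?_
    rw [Finset.mul_sum]
    exact Finset.sum_congr rfl fun j _ => by ring
  · have h4 : ∀ᵐ x ∂π, ∀ k, (c k • g k : Lp ℝ 2 π) x = c k * f k x := ae_all_iff.2 fun k => by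
      filter_upwards [Lp.coeFn_smul (c k) (g k), hgf k] with x hx1 hx2
      rw [hx1, Pi.smul_apply, hx2, smul_eq_mul]
    filter_upwards [Lp.coeFn_finsetSum Finset.univ fun k => c k • g k, h4] with x hx1 hx2
    rw [hx1]
    simp [hx2]

lemma dense_hasLipConst (π : Measure (ι → ℝ)) [IsFiniteMeasure π] :
    Dense {g : Lp ℝ 2 π | ∃ L, HasLipConst π g L} := by
  refine (Lp.dense_hasCompactSupport_contDiff (F := ℝ) (μ := π) (p := 2) (by simp)).mono ?_
  rintro g ⟨f, hgf, hf1, hf2⟩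
  obtain ⟨C, hC⟩ := hf2.lipschitzWith_of_hasCompactSupport hf1 (by simp)
  obtain ⟨M, hM⟩ := hf1.exists_bound_of_continuous hf2.continuous
  refine ⟨fun _ => C, fun _ => C.2, f, ⟨⟨M, hM⟩, fun x y => ?_⟩, hgf⟩
  refine (hC.dist_le_mul x y).trans ?_
  rw [← Finset.mul_sum]
  refine mul_le_mul_of_nonneg_left ?_ C.2
  refine (dist_pi_le_iff (Finset.sum_nonneg fun _ _ => abs_nonneg _)).2 fun j => ?_
  exact Finset.single_le_sum (f := fun j => |x j - y j|) (fun _ _ => abs_nonneg _)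
    (Finset.mem_univ j)

/-- For a law with second moments, the weighted sum of the Lipschitz constants controls the
distance to the mean in `L²`. -/
lemma exists_norm_sub_le_of_hasLipConst {π : Measure (ι → ℝ)} [IsProbabilityMeasure π]
    (hπ : ∀ j, MemLp (fun x : ι → ℝ => x j) 2 π) {w : ι → ℝ} (hw : ∀ j, 0 < w j) :
    ∃ M : ℝ, 0 ≤ M ∧ ∀ g L, HasLipConst π g L →
      ‖g - condExpOp π bot_le g‖ ≤ M * ∑ j, w j * L j := by
  have hint : ∀ j, Integrable (fun x : ι → ℝ => |x j|) π := fun j =>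
    ((hπ j).integrable one_le_two).abs
  set h : (ι → ℝ) → ℝ := fun x => ∑ j, (w j)⁻¹ * (|x j| + ∫ y, |y j| ∂π) with hh
  have hmem : MemLp h 2 π := by
    refine memLp_finsetSum _ fun j _ => MemLp.const_mul ?_ _
    exact (hπ j).abs.add (memLp_const _)
  have hpos : ∀ x, 0 ≤ h x := fun x => Finset.sum_nonneg fun j _ =>
    mul_nonneg (inv_nonneg.2 (hw j).le)
      (add_nonneg (abs_nonneg _) (integral_nonneg fun _ => abs_nonneg _))
  refine ⟨‖hmem.toLp h‖, norm_nonneg _, fun g L ⟨hL, f, hf, hgf⟩ => ?_⟩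
  rw [mul_comm]
  refine Lp.norm_le_mul_norm_of_ae_le_mul ?_
  have hQ : condExpOp π bot_le g =ᵐ[π] fun _ => ∫ y, f y ∂π := by
    refine (condExpOp_ae_eq π _ g).trans ?_
    rw [condExp_bot, integral_congr_ae hgf]
  filter_upwards [Lp.coeFn_sub g (condExpOp π bot_le g), hQ, hgf, hmem.coeFn_toLp]
    with x hx1 hx2 hx3 hx4
  rw [hx1, Pi.sub_apply, hx2, hx3, hx4, Real.norm_of_nonneg (hpos x)]
  have h1 : f x - ∫ y, f y ∂π = ∫ y, (f x - f y) ∂π := by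
    rw [integral_sub (integrable_const _) (hf.integrable π)]
    simp
  have hterm : ∀ j, Integrable (fun y : ι → ℝ => L j * (|x j| + |y j|)) π := fun j =>
    ((integrable_const _).add (hint j)).const_mul _
  have hmaj : Integrable (fun y : ι → ℝ => ∑ j, L j * (|x j| + |y j|)) π :=
    integrable_finsetSum _ fun j _ => hterm j
  calc ‖f x - ∫ y, f y ∂π‖ ≤ ∫ y, ∑ j, L j * (|x j| + |y j|) ∂π := by
        rw [h1]
        refine norm_integral_le_of_norm_le hmaj (ae_of_all _ fun y => ?_)
        exact (hf.abs_sub_le x y).trans (Finset.sum_le_sum fun j _ =>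
          mul_le_mul_of_nonneg_left (abs_sub _ _) (hL j))
    _ = ∑ j, L j * (|x j| + ∫ y, |y j| ∂π) := by
        rw [integral_finsetSum _ fun j _ => hterm j]
        refine Finset.sum_congr rfl fun j _ => ?_
        rw [integral_const_mul, integral_add (integrable_const _) (hint j)]
        simp
    _ ≤ ∑ j, (∑ i, w i * L i) * ((w j)⁻¹ * (|x j| + ∫ y, |y j| ∂π)) := by
        refine Finset.sum_le_sum fun j _ => ?_
        have h2 : w j * L j ≤ ∑ i, w i * L i :=
          Finset.single_le_sum (f := fun i => w i * L i)
            (fun i _ => mul_nonneg (hw i).le (hL i)) (Finset.mem_univ j)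
        have h3 : 0 ≤ (w j)⁻¹ * (|x j| + ∫ y, |y j| ∂π) := mul_nonneg (inv_nonneg.2 (hw j).le)
          (add_nonneg (abs_nonneg _) (integral_nonneg fun _ => abs_nonneg _))
        refine le_trans (le_of_eq ?_) (mul_le_mul_of_nonneg_right h2 h3)
        have := (hw j).ne'
        field_simp
    _ = (∑ i, w i * L i) * h x := by rw [← Finset.mul_sum]

end Lipschitz

/-! ### Contraction of a Gibbs sweep -/

section SweepContraction

variable {m : ℕ} (S : BlockingScheme m)

/-- The mean dynamics of the `i`-th step of a sweep. -/
noncomputable def BlockingScheme.stepMean (B : Matrix (Fin m) (Fin m) ℝ) (i : Fin S.k)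
    (u : Fin m → ℝ) : Fin m → ℝ :=
  fun l => ∑ j, (S.q i j).toReal * blockMean B (fun a => S.cls a = j) u l

lemma BlockingScheme.sum_toReal_q (i : Fin S.k) : ∑ j, (S.q i j).toReal = 1 := by
  rw [← ENNReal.toReal_sum fun j _ => (S.q i).apply_ne_top j, S.sum_q, ENNReal.toReal_one]

variable {B : Matrix (Fin m) (Fin m) ℝ}

lemma blockMean_mono {ι : Type*} [Fintype ι] {B : Matrix ι ι ℝ} (hB : ∀ i j, 0 ≤ B i j)
    (p : ι → Prop) [DecidablePred p] {u v : ι → ℝ} (h : ∀ l, u l ≤ v l) (l : ι) :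
    blockMean B p u l ≤ blockMean B p v l := by
  unfold blockMean
  split_ifs
  · exact Finset.sum_le_sum fun j _ => mul_le_mul_of_nonneg_left (h j) (hB l j)
  · exact h l

lemma BlockingScheme.stepMean_mono (hB : ∀ i j, 0 ≤ B i j) (i : Fin S.k) {u v : Fin m → ℝ}
    (h : ∀ l, u l ≤ v l) (l : Fin m) : S.stepMean B i u l ≤ S.stepMean B i v l :=
  Finset.sum_le_sum fun _ _ =>
    mul_le_mul_of_nonneg_left (blockMean_mono hB _ h l) ENNReal.toReal_nonneg

lemma BlockingScheme.foldl_stepMean_mono (hB : ∀ i j, 0 ≤ B i j) (l : List (Fin S.k))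
    {u v : Fin m → ℝ} (h : ∀ a, u a ≤ v a) (a : Fin m) :
    l.foldl (fun u i => S.stepMean B i u) u a ≤ l.foldl (fun u i => S.stepMean B i u) v a := by
  induction l generalizing u v with
  | nil => exact h a
  | cons i l ih => exact ih (S.stepMean_mono hB i h)

lemma BlockingScheme.foldl_stepMean_le (hB : ∀ i j, 0 ≤ B i j) {w : Fin m → ℝ}
    (hw : ∀ i a, S.stepMean B i w a ≤ w a) (l : List (Fin S.k)) (a : Fin m) :
    l.foldl (fun u i => S.stepMean B i u) w a ≤ w a := by
  induction l with
  | nil => exact le_rfl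
  | cons i l ih => exact (S.foldl_stepMean_mono hB l (hw i) a).trans ih

lemma BlockingScheme.star_stepOp (π : Measure (Fin m → ℝ)) (i : Fin S.k) :
    star (S.stepOp π i) = S.stepOp π i := by
  simp [BlockingScheme.stepOp, star_sum, star_smul, star_condExpOp]

lemma BlockingScheme.star_sweepOp (π : Measure (Fin m → ℝ)) :
    star (S.sweepOp π) = ((List.finRange S.k).reverse.map (S.stepOp π)).prod := by
  have key : ∀ l : List (Fin S.k), star (l.map (S.stepOp π)).prod =
      (l.reverse.map (S.stepOp π)).prod := by
    intro l
    induction l with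
    | nil => simp
    | cons i l ih => simp [ih, S.star_stepOp π]
  exact key _

variable {π : Measure (Fin m → ℝ)} [IsFiniteMeasure π]

lemma BlockingScheme.exists_hasLipConst_stepOp (h : HasLinearCondMeans π B)
    (hB : ∀ i j, 0 ≤ B i j) (hS : ∀ j l, S.cls j = S.cls l → B j l = 0) (i : Fin S.k)
    {g : Lp ℝ 2 π} {L : Fin m → ℝ} (hg : HasLipConst π g L) :
    ∃ L', HasLipConst π (S.stepOp π i g) L' ∧
      ∀ u, ∑ l, u l * L' l = ∑ l, S.stepMean B i u l * L l := by
  refine ⟨fun l => ∑ j, (S.q i j).toReal * blockLip B (fun a => S.cls a = j) L l, ?_, fun u => ?_⟩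
  · have : S.stepOp π i g = ∑ j, (S.q i j).toReal • condExpOp π (S.others_le j) g := by
      simp [BlockingScheme.stepOp]
    rw [this]
    refine hasLipConst_sum (fun j => ENNReal.toReal_nonneg) fun j => ?_
    exact h.hasLipConst_condExpOp hB (fun a => S.cls a = j)
      (fun a b ha hb => hS a b (ha.trans hb.symm)) (S.others_le j) hg
  · simp_rw [BlockingScheme.stepMean, Finset.mul_sum, Finset.sum_mul]
    rw [Finset.sum_comm, Finset.sum_comm (γ := Fin m)]
    refine Finset.sum_congr rfl fun j _ => ?_
    calc ∑ l, u l * ((S.q i j).toReal * blockLip B (fun a => S.cls a = j) L l)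
        = (S.q i j).toReal * ∑ l, u l * blockLip B (fun a => S.cls a = j) L l := by
          rw [Finset.mul_sum]; exact Finset.sum_congr rfl fun l _ => by ring
      _ = _ := by
          rw [sum_mul_blockLip, Finset.mul_sum]; exact Finset.sum_congr rfl fun l _ => by ring

/-- Duality between the Lipschitz constants and the mean dynamics over several steps. -/
lemma BlockingScheme.exists_hasLipConst_prod (h : HasLinearCondMeans π B)
    (hB : ∀ i j, 0 ≤ B i j) (hS : ∀ j l, S.cls j = S.cls l → B j l = 0) (l : List (Fin S.k))
    {g : Lp ℝ 2 π} {L : Fin m → ℝ} (hg : HasLipConst π g L) :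
    ∃ L', HasLipConst π ((l.map (S.stepOp π)).prod g) L' ∧
      ∀ u, ∑ a, u a * L' a = ∑ a, l.foldl (fun u i => S.stepMean B i u) u a * L a := by
  induction l with
  | nil => exact ⟨L, by simpa using hg, fun u => by simp⟩
  | cons i l ih =>
    obtain ⟨L₁, h₁, e₁⟩ := ih
    obtain ⟨L₂, h₂, e₂⟩ := S.exists_hasLipConst_stepOp h hB hS i h₁
    exact ⟨L₂, by simpa using h₂, fun u => by rw [e₂, e₁, List.foldl_cons]⟩

lemma BlockingScheme.stepOp_mul_bot (i : Fin S.k) :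
    S.stepOp π i * condExpOp π bot_le = condExpOp π bot_le := by
  simp only [BlockingScheme.stepOp, Finset.sum_mul, smul_mul_assoc,
    condExpOp_mul_of_ge π _ _ bot_le]
  rw [← Finset.sum_smul, S.sum_toReal_q, one_smul]

lemma BlockingScheme.sweepOp_mul_bot :
    S.sweepOp π * condExpOp π bot_le = condExpOp π bot_le := by
  unfold BlockingScheme.sweepOp
  induction List.finRange S.k with
  | nil => simp
  | cons i l ih => rw [List.map_cons, List.prod_cons, mul_assoc, ih, S.stepOp_mul_bot]

lemma BlockingScheme.bot_mul_sweepOp :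
    condExpOp π bot_le * S.sweepOp π = condExpOp π bot_le := by
  have h1 : ∀ i, condExpOp π bot_le * S.stepOp π i = condExpOp π bot_le := fun i => by
    have := congrArg star (S.stepOp_mul_bot (π := π) i)
    rwa [star_mul, star_condExpOp, S.star_stepOp] at this
  unfold BlockingScheme.sweepOp
  induction List.finRange S.k with
  | nil => simp
  | cons i l ih => rw [List.map_cons, List.prod_cons, ← mul_assoc, h1, ih]

/-- If the mean dynamics of a sweep contracts a positive vector by the factor `r`, and no step
expands it, then a sweep contracts the centred functions in `L²(π)` by the factor `√r`. -/
lemma BlockingScheme.opNorm_sweepOp_sub_le (h : HasLinearCondMeans π B)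
    (hB : ∀ i j, 0 ≤ B i j) (hS : ∀ j l, S.cls j = S.cls l → B j l = 0) {w : Fin m → ℝ}
    (hw : ∀ a, 0 < w a) (hstep : ∀ i a, S.stepMean B i w a ≤ w a) {r : ℝ} (hr : 0 ≤ r)
    (hfold : ∀ a, (List.finRange S.k).foldl (fun u i => S.stepMean B i u) w a ≤ r * w a) :
    ‖S.sweepOp π - condExpOp π bot_le‖ ≤ √r := by
  have hprob : IsProbabilityMeasure π := h.gaussian.isProbabilityMeasure
  obtain ⟨M, hM0, hM⟩ := exists_norm_sub_le_of_hasLipConst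
    (fun j => (h.gaussian.eval j).memLp_two) hw
  have hpow : ∀ (g : Lp ℝ 2 π) (L : Fin m → ℝ), HasLipConst π g L → ∀ n : ℕ, ∃ L',
      HasLipConst π (((S.sweepOp π * star (S.sweepOp π)) ^ n) g) L' ∧
        ∑ a, w a * L' a ≤ r ^ n * ∑ a, w a * L a := by
    intro g L hg n
    induction n with
    | zero => exact ⟨L, by simpa using hg, by simp⟩
    | succ n ih =>
      obtain ⟨L₀, h₀, e₀⟩ := ih
      obtain ⟨L₁, h₁, e₁⟩ :=
        S.exists_hasLipConst_prod h hB hS (List.finRange S.k).reverse h₀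
      obtain ⟨L₂, h₂, e₂⟩ := S.exists_hasLipConst_prod h hB hS (List.finRange S.k) h₁
      refine ⟨L₂, ?_, ?_⟩
      · rw [pow_succ', S.star_sweepOp]
        rw [S.star_sweepOp] at h₂
        exact h₂
      · calc ∑ a, w a * L₂ a ≤ ∑ a, (r * w a) * L₁ a := by
              rw [e₂]
              exact Finset.sum_le_sum fun a _ => mul_le_mul_of_nonneg_right (hfold a) (h₁.1 a)
          _ = r * ∑ a, w a * L₁ a := by
              rw [Finset.mul_sum]; exact Finset.sum_congr rfl fun a _ => by ring
          _ ≤ r * ∑ a, w a * L₀ a := by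
              rw [e₁]
              exact mul_le_mul_of_nonneg_left (Finset.sum_le_sum fun a _ =>
                mul_le_mul_of_nonneg_right (S.foldl_stepMean_le hB hstep _ a) (h₀.1 a)) hr
          _ ≤ r * (r ^ n * ∑ a, w a * L a) := mul_le_mul_of_nonneg_left e₀ hr
          _ = _ := by ring
  have hPstar : condExpOp π bot_le * star (S.sweepOp π) = condExpOp π bot_le := by
    have := congrArg star (S.sweepOp_mul_bot (π := π))
    rwa [star_mul, star_condExpOp] at this
  have hQT : ∀ n : ℕ, condExpOp π bot_le * (S.sweepOp π * star (S.sweepOp π)) ^ n =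
      condExpOp π bot_le := fun n => by
    induction n with
    | zero => simp
    | succ n ih => rw [pow_succ', ← mul_assoc, ← mul_assoc, S.bot_mul_sweepOp, hPstar, ih]
  refine opNorm_sub_le_sqrt (star_condExpOp π _) S.sweepOp_mul_bot S.bot_mul_sweepOp
    (condExpOp_mul_of_le π _ _ le_rfl) hr (dense_hasLipConst π) ?_
  rintro g ⟨L, hg⟩
  refine ⟨M * ∑ a, w a * L a, fun n => ?_⟩
  obtain ⟨L', h', e'⟩ := hpow g L hg n
  have h1 := hM _ _ h'
  have h2 : condExpOp π bot_le (((S.sweepOp π * star (S.sweepOp π)) ^ n) g) =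
      condExpOp π bot_le g := by
    conv_rhs => rw [← hQT n]
    rfl
  rw [h2] at h1
  calc _ ≤ M * ∑ a, w a * L' a := h1
    _ ≤ M * (r ^ n * ∑ a, w a * L a) := mul_le_mul_of_nonneg_left e' hM0
    _ = _ := by ring

end SweepContraction

/-! ### Mean contraction of the three schemes -/

section Schemes

variable {m : ℕ} (S : BlockingScheme m) {B : Matrix (Fin m) (Fin m) ℝ} {w : Fin m → ℝ} {γ : ℝ}

lemma blockMean_le {ι : Type*} [Fintype ι] {B : Matrix ι ι ℝ} {w : ι → ℝ} {γ : ℝ}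
    (hBw : ∀ a, ∑ j, B a j * w j ≤ γ * w a) (p : ι → Prop) [DecidablePred p] (a : ι) :
    blockMean B p w a ≤ if p a then γ * w a else w a := by
  unfold blockMean
  split_ifs
  · exact hBw a
  · exact le_rfl

lemma BlockingScheme.stepMean_le (hBw : ∀ a, ∑ j, B a j * w j ≤ γ * w a) (i : Fin S.k)
    (a : Fin m) : S.stepMean B i w a ≤ (1 - (1 - γ) * (S.q i (S.cls a)).toReal) * w a := by
  calc S.stepMean B i w a
      ≤ ∑ j, ((S.q i j).toReal * w a - if j = S.cls a then (S.q i j).toReal * ((1 - γ) * w a)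
          else 0) := by
        refine Finset.sum_le_sum fun j _ => ?_
        refine (mul_le_mul_of_nonneg_left (blockMean_le hBw _ a)
          ENNReal.toReal_nonneg).trans_eq ?_
        rcases eq_or_ne j (S.cls a) with rfl | hj
        · simp; ring
        · simp [hj, hj.symm]
    _ = _ := by
        rw [Finset.sum_sub_distrib, ← Finset.sum_mul, S.sum_toReal_q]
        simp; ring

lemma BlockingScheme.stepMean_le_self (hw : ∀ a, 0 < w a) (hγ : γ ≤ 1)
    (hBw : ∀ a, ∑ j, B a j * w j ≤ γ * w a) (i : Fin S.k) (a : Fin m) :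
    S.stepMean B i w a ≤ w a := by
  refine (S.stepMean_le hBw i a).trans (mul_le_of_le_one_left (hw a).le ?_)
  have : 0 ≤ (1 - γ) * (S.q i (S.cls a)).toReal :=
    mul_nonneg (by linarith) ENNReal.toReal_nonneg
  linarith

/-- In a sweep that updates every class, each coordinate is contracted at least once. -/
lemma BlockingScheme.foldl_stepMean_le_of_pure (hB : ∀ i j, 0 ≤ B i j) (hw : ∀ a, 0 < w a)
    (hγ : γ ≤ 1) (hBw : ∀ a, ∑ j, B a j * w j ≤ γ * w a) (hq : ∀ i, S.q i = PMF.pure i)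
    (a : Fin m) :
    (List.finRange S.k).foldl (fun u i => S.stepMean B i u) w a ≤ γ * w a := by
  have hstep : ∀ i u, S.stepMean B i u = blockMean B (fun a => S.cls a = i) u := by
    intro i u
    funext l
    unfold BlockingScheme.stepMean
    rw [Finset.sum_eq_single i]
    · simp [hq]
    · intro j _ hj
      simp [hq, hj]
    · simp
  have key : ∀ l : List (Fin S.k), ∀ a,
      l.foldl (fun u i => S.stepMean B i u) w a ≤ w a ∧
      (S.cls a ∈ l → l.foldl (fun u i => S.stepMean B i u) w a ≤ γ * w a) := by
    intro l
    induction l using List.reverseRecOn with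
    | nil => intro a; simp
    | append_singleton l i ih =>
      intro a
      rw [List.foldl_append, List.foldl_cons, List.foldl_nil, hstep]
      have h1 := blockMean_mono hB (fun a => S.cls a = i) (fun b => (ih b).1) a
      have h2 := h1.trans (blockMean_le hBw _ a)
      by_cases ha : S.cls a = i
      · rw [if_pos ha] at h2
        exact ⟨h2.trans (mul_le_of_le_one_left (hw a).le hγ), fun _ => h2⟩
      · have h3 : blockMean B (fun a => S.cls a = i)
            (l.foldl (fun u i => S.stepMean B i u) w) a =
            l.foldl (fun u i => S.stepMean B i u) w a := if_neg ha
        rw [h3]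
        refine ⟨(ih a).1, fun hmem => (ih a).2 ?_⟩
        simpa [ha] using hmem
  exact (key _ a).2 (List.mem_finRange _)

lemma BlockingScheme.foldl_stepMean_le_of_uniform (hm : 0 < m) (hB : ∀ i j, 0 ≤ B i j)
    (hw : ∀ a, 0 < w a) (hγ0 : 0 ≤ γ) (hγ : γ ≤ 1) (hBw : ∀ a, ∑ j, B a j * w j ≤ γ * w a)
    (hk : S.k = m) (hq : ∀ i j, S.q i j = (m : ℝ≥0∞)⁻¹) (a : Fin m) :
    (List.finRange S.k).foldl (fun u i => S.stepMean B i u) w a ≤ (1 - (1 - γ) / 2) * w a := by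
  have hm' : (0 : ℝ) < m := by exact_mod_cast hm
  have hm1 : (1 : ℝ) ≤ m := by exact_mod_cast hm
  set s : ℝ := 1 - (1 - γ) / m with hs
  have hs0 : 0 ≤ s := by
    have : (1 - γ) / m ≤ 1 := (div_le_one hm').2 (by linarith)
    linarith
  have hstep : ∀ i a, S.stepMean B i w a ≤ s * w a := fun i a => by
    refine (S.stepMean_le hBw i a).trans_eq ?_
    rw [hq, hs, ENNReal.toReal_inv, ENNReal.toReal_natCast, div_eq_mul_inv]
  have hlin : ∀ i (c : ℝ) (u : Fin m → ℝ) a,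
      S.stepMean B i (fun l => c * u l) a = c * S.stepMean B i u a := by
    intro i c u a
    simp only [BlockingScheme.stepMean, Finset.mul_sum]
    refine Finset.sum_congr rfl fun j _ => ?_
    unfold blockMean
    split_ifs
    · rw [Finset.mul_sum, Finset.mul_sum, Finset.mul_sum]
      exact Finset.sum_congr rfl fun l _ => by ring
    · ring
  have key : ∀ l : List (Fin S.k), ∀ a,
      l.foldl (fun u i => S.stepMean B i u) w a ≤ s ^ l.length * w a := by
    intro l
    induction l using List.reverseRecOn with
    | nil => intro a; simp
    | append_singleton l i ih =>
      intro a
      rw [List.foldl_append, List.foldl_cons, List.foldl_nil]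
      refine (S.stepMean_mono hB i ih a).trans ?_
      rw [hlin, List.length_append, List.length_singleton, pow_succ, mul_assoc]
      exact mul_le_mul_of_nonneg_left (hstep i a) (pow_nonneg hs0 _)
  refine (key _ a).trans (mul_le_mul_of_nonneg_right ?_ (hw a).le)
  rw [List.length_finRange, hk]
  -- `(1 - x / m) ^ m ≤ exp (-x) ≤ 1 - x / 2` for `0 ≤ x ≤ 1`
  have h1 : s ≤ Real.exp (-((1 - γ) / m)) := by
    have := Real.add_one_le_exp (-((1 - γ) / m))
    linarith
  have h2 : s ^ m ≤ Real.exp (-(1 - γ)) := by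
    calc s ^ m ≤ Real.exp (-((1 - γ) / m)) ^ m := pow_le_pow_left₀ hs0 h1 m
      _ = Real.exp (-(1 - γ)) := by
        rw [← Real.exp_nat_mul]; congr 1; field_simp
  have h3 : Real.exp (-(1 - γ)) ≤ 1 - (1 - γ) / 2 := by
    have h4 : Real.exp (-(1 - γ)) * (1 + (1 - γ)) ≤ 1 := by
      rw [Real.exp_neg]
      have := Real.add_one_le_exp (1 - γ)
      rw [inv_mul_le_iff₀ (Real.exp_pos _)]
      linarith
    nlinarith [mul_nonneg hγ0 (sub_nonneg.2 hγ)]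
  exact h2.trans h3

end Schemes

/-! ### Nearest-neighbour conditional means -/

section NearestNeighbour

/-- The matrix that maps `x` to the `β`-fold sums of the two neighbours of each coordinate (of the
only neighbour, at the two ends). -/
def neighbourMatrix (m : ℕ) (β : ℝ) : Matrix (Fin m) (Fin m) ℝ :=
  fun i j => if (i : ℕ) + 1 = j ∨ (j : ℕ) + 1 = i then β else 0

/-- A sequence that vanishes at the two ends `0` and `m + 1` needs no boundary terms. -/
lemma sum_neighbourMatrix_mul {m : ℕ} (β : ℝ) {f : ℕ → ℝ} (h0 : f 0 = 0) (hm : f (m + 1) = 0)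
    (i : Fin m) :
    ∑ j : Fin m, neighbourMatrix m β i j * f (j + 1) = β * (f i + f (i + 2)) := by
  have h1 : ∀ j : ℕ, (if (i : ℕ) + 1 = j ∨ j + 1 = i then β else 0) * f (j + 1) =
      (if (i : ℕ) + 1 = j then β * f (j + 1) else 0) + if j + 1 = i then β * f i else 0 := by
    intro j
    by_cases h2 : (i : ℕ) + 1 = j
    · have h3 : ¬ j + 1 = i := by omega
      simp [h2, h3]
    · by_cases h3 : j + 1 = (i : ℕ)
      · simp [h2, h3]
      · simp [h2, h3]
  unfold neighbourMatrix
  rw [Fin.sum_univ_eq_sum_range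
    (fun j => (if (i : ℕ) + 1 = j ∨ j + 1 = i then β else 0) * f (j + 1)) m]
  simp_rw [h1]
  rw [Finset.sum_add_distrib, Finset.sum_ite_eq, mul_add, add_comm]
  congr 1
  · rcases Nat.eq_zero_or_pos (i : ℕ) with hi | hi
    · rw [hi, h0]; simp
    · rw [Finset.sum_eq_single ((i : ℕ) - 1)]
      · rw [if_pos (by omega)]
      · intro j _ hj
        exact if_neg (by omega)
      · intro h
        exact absurd (Finset.mem_range.2 (by omega)) h
  · split_ifs with h
    · rfl
    · have : (i : ℕ) + 1 = m := by
        have := i.2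
        rw [Finset.mem_range] at h
        omega
      rw [show (i : ℕ) + 2 = m + 1 by omega, hm, mul_zero]

lemma neighbourMatrix_nonneg {m : ℕ} {β : ℝ} (hβ : 0 ≤ β) (i j : Fin m) :
    0 ≤ neighbourMatrix m β i j := by
  unfold neighbourMatrix
  split_ifs <;> simp [hβ]

/-- The concave weights `(a + 1) (m - a)`, of second difference `-2`, are contracted by a factor
`1 - O(m⁻²)`. -/
lemma sum_neighbourMatrix_mul_weight_le {m : ℕ} {β : ℝ} (hβ : β ≤ 1 / 2)
    (a : Fin m) :
    ∑ j : Fin m, neighbourMatrix m β a j * (((j : ℕ) + 1 : ℝ) * ((m : ℝ) - (j : ℕ))) ≤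
      (1 - 4 / ((m : ℝ) + 1) ^ 2) * (((a : ℕ) + 1 : ℝ) * ((m : ℝ) - (a : ℕ))) := by
  have h := sum_neighbourMatrix_mul (m := m) β (f := fun n : ℕ => (n : ℝ) * ((m : ℝ) + 1 - n))
    (by simp) (by push_cast; ring) a
  have ha : ((a : ℕ) : ℝ) + 1 ≤ m := by exact_mod_cast a.2
  have ha0 : (0 : ℝ) ≤ (a : ℕ) := Nat.cast_nonneg _
  calc _ = ∑ j : Fin m, neighbourMatrix m β a j *
        (((j : ℕ) + 1 : ℕ) * ((m : ℝ) + 1 - ((j : ℕ) + 1 : ℕ))) := by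
        refine Finset.sum_congr rfl fun j _ => ?_
        push_cast; ring
    _ = _ := h
    _ ≤ _ := by
      push_cast
      set x : ℝ := ((a : ℕ) : ℝ)
      set N : ℝ := (m : ℝ) + 1 with hN
      have hm : (m : ℝ) = N - 1 := by linarith
      have hNpos : 0 < N := by linarith
      rw [hm]
      have h1 : 0 ≤ x * (N - x) + (x + 2) * (N - (x + 2)) := by
        have : 0 ≤ N - (x + 2) := by linarith
        have : 0 ≤ N - x := by linarith
        positivity
      have h2 : β * (x * (N - x) + (x + 2) * (N - (x + 2))) ≤
          1 / 2 * (x * (N - x) + (x + 2) * (N - (x + 2))) := by gcongr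
      refine h2.trans ?_
      -- the maximum of `y (N - y)` is `N ^ 2 / 4`
      have h3 : 4 / N ^ 2 * ((x + 1) * (N - 1 - x)) ≤ 1 := by
        rw [div_mul_eq_mul_div, div_le_one (by positivity)]
        nlinarith [sq_nonneg (N - 2 * (x + 1))]
      nlinarith

lemma BlockingScheme.neighbourMatrix_eq_zero {m : ℕ} {S : BlockingScheme m} (β : ℝ)
    (hS : S.IsCheckerboard ∨ S.IsLexicographic ∨ S.IsRandom) (j l : Fin m)
    (h : S.cls j = S.cls l) : neighbourMatrix m β j l = 0 := by
  unfold neighbourMatrix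
  refine if_neg ?_
  rcases hS with ⟨-, hS, -⟩ | ⟨-, hS, -⟩ | ⟨-, hS, -⟩
  · rintro (hj | hj)
    · obtain ⟨b, -, h1, h2⟩ := hS j l h (by rw [Fin.lt_def]; omega)
      rw [Fin.lt_def] at h1 h2
      omega
    · obtain ⟨b, -, h1, h2⟩ := hS l j h.symm (by rw [Fin.lt_def]; omega)
      rw [Fin.lt_def] at h1 h2
      omega
  all_goals
    have h1 := hS j
    rw [h, hS l] at h1
    omega

/-- The mean dynamics contracts by a factor `1 - 2 / (m + 1) ^ 2` per sweep, so that the `L²`-rate is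
at most the square root of this factor. -/
lemma sqrt_mem_l2Rates {m : ℕ} (hm : 1 ≤ m) {S : BlockingScheme m}
    (hS : S.IsCheckerboard ∨ S.IsLexicographic ∨ S.IsRandom)
    {π : Measure (Fin m → ℝ)} [IsProbabilityMeasure π] {β : ℝ} (hβ0 : 0 ≤ β) (hβ : β ≤ 1 / 2)
    (hπ : HasLinearCondMeans π (neighbourMatrix m β)) :
    √(1 - 2 / ((m : ℝ) + 1) ^ 2) ∈ l2Rates π (S.sweep π) := by
  have hm1 : (1 : ℝ) ≤ m := by exact_mod_cast hm
  set γ : ℝ := 1 - 4 / ((m : ℝ) + 1) ^ 2 with hγ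
  have hγ1 : γ ≤ 1 := by
    have : 0 ≤ 4 / ((m : ℝ) + 1) ^ 2 := by positivity
    linarith
  have hγ0 : 0 ≤ γ := by
    have : 4 / ((m : ℝ) + 1) ^ 2 ≤ 1 := by
      rw [div_le_one (by positivity)]; nlinarith
    linarith
  have hr : 1 - 2 / ((m : ℝ) + 1) ^ 2 = 1 - (1 - γ) / 2 := by rw [hγ]; ring
  set w : Fin m → ℝ := fun a => ((a : ℕ) + 1 : ℝ) * ((m : ℝ) - (a : ℕ)) with hw
  have hwpos : ∀ a, 0 < w a := fun a => by
    have : ((a : ℕ) : ℝ) + 1 ≤ m := by exact_mod_cast a.2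
    have : (0 : ℝ) < m - (a : ℕ) := by linarith
    positivity
  have hB := fun i j => neighbourMatrix_nonneg (m := m) hβ0 i j
  have hBw : ∀ a, ∑ j, neighbourMatrix m β a j * w j ≤ γ * w a :=
    fun a => sum_neighbourMatrix_mul_weight_le hβ a
  have hfold : ∀ a, (List.finRange S.k).foldl (fun u i => S.stepMean (neighbourMatrix m β) i u) w a
      ≤ (1 - (1 - γ) / 2) * w a := by
    have hpure : (∀ i, S.q i = PMF.pure i) → ∀ a,
        (List.finRange S.k).foldl (fun u i => S.stepMean (neighbourMatrix m β) i u) w a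
        ≤ (1 - (1 - γ) / 2) * w a := fun hq a =>
      (S.foldl_stepMean_le_of_pure hB hwpos hγ1 hBw hq a).trans
        (mul_le_mul_of_nonneg_right (by linarith) (hwpos a).le)
    rcases hS with hS | hS | hS
    · exact hpure hS.2.2
    · exact hpure hS.2.2
    · exact S.foldl_stepMean_le_of_uniform hm hB hwpos hγ0 hγ1 hBw hS.1 hS.2.2
  obtain ⟨hM, hrep⟩ := S.represents_sweep π
  rw [hr]
  exact mem_l2Rates_of_opNorm_le hrep S.sweepOp_mul_bot S.bot_mul_sweepOp (Real.sqrt_nonneg _)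
    (S.opNorm_sweepOp_sub_le hπ hB (BlockingScheme.neighbourMatrix_eq_zero β hS) hwpos
      (S.stepMean_le_self hwpos hγ1 hBw) (by linarith) hfold)

lemma sqrt_one_sub_le {x : ℝ} (hx : x ≤ 1) : √(1 - x) ≤ 1 - x / 2 := by
  rw [Real.sqrt_le_left (by linarith)]
  nlinarith [sq_nonneg x]

end NearestNeighbour

/-! ### Innovations of the discretely observed process -/

section Pathwise

/-- A driving path `h` of the linear equation `dx = -θ x dt + dh` determines the innovation of `x`
over an interval as a limit of exponentially weighted sums of increments. -/
lemma tendsto_sum_exp_mul_increments {x h : ℝ → ℝ} (hx : Continuous x) {θ : ℝ}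
    (hh : ∀ s t, 0 ≤ s → s ≤ t → h t - h s = x t - x s + θ * ∫ u in s..t, x u)
    {a δ : ℝ} (ha : 0 ≤ a) (hδ : 0 ≤ δ) :
    Tendsto (fun n : ℕ => ∑ k ∈ Finset.range (n + 1),
      Real.exp (-θ * (δ - k * (δ / (n + 1 : ℕ)))) *
        (h (a + (k + 1 : ℕ) * (δ / (n + 1 : ℕ))) - h (a + k * (δ / (n + 1 : ℕ)))))
      atTop (𝓝 (x (a + δ) - Real.exp (-θ * δ) * x a)) := by
  -- the summands of the error of the sum with mesh `η`
  have herr : ∀ n : ℕ, (∑ k ∈ Finset.range (n + 1),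
      Real.exp (-θ * (δ - k * (δ / (n + 1 : ℕ)))) *
        (h (a + (k + 1 : ℕ) * (δ / (n + 1 : ℕ))) - h (a + k * (δ / (n + 1 : ℕ))))) -
      (x (a + δ) - Real.exp (-θ * δ) * x a) =
      ∑ k ∈ Finset.range (n + 1), Real.exp (-θ * (δ - k * (δ / (n + 1 : ℕ)))) *
        (θ * (∫ u in (a + k * (δ / (n + 1 : ℕ)))..(a + (k + 1 : ℕ) * (δ / (n + 1 : ℕ))),
          (x u - x (a + (k + 1 : ℕ) * (δ / (n + 1 : ℕ))))) -
        (Real.exp (θ * (δ / (n + 1 : ℕ))) - 1 - θ * (δ / (n + 1 : ℕ))) *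
          x (a + (k + 1 : ℕ) * (δ / (n + 1 : ℕ)))) := by
    intro n
    set η : ℝ := δ / (n + 1 : ℕ) with hη
    have hη0 : 0 ≤ η := by positivity
    have hnη : ((n + 1 : ℕ) : ℝ) * η = δ := by rw [hη]; field_simp
    have htel : x (a + δ) - Real.exp (-θ * δ) * x a = ∑ k ∈ Finset.range (n + 1),
        (Real.exp (-θ * (δ - (k + 1 : ℕ) * η)) * x (a + (k + 1 : ℕ) * η) -
          Real.exp (-θ * (δ - k * η)) * x (a + k * η)) := by
      rw [Finset.sum_range_sub (fun k : ℕ => Real.exp (-θ * (δ - k * η)) * x (a + k * η)), hnη]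
      simp
    rw [htel, ← Finset.sum_sub_distrib]
    refine Finset.sum_congr rfl fun k _ => ?_
    have hle : a + k * η ≤ a + (k + 1 : ℕ) * η := by push_cast; nlinarith
    rw [hh _ _ (by positivity) hle, intervalIntegral.integral_sub
      (hx.intervalIntegrable _ _) (by simp), intervalIntegral.integral_const, smul_eq_mul]
    have hexp : Real.exp (-θ * (δ - (k + 1 : ℕ) * η)) =
        Real.exp (-θ * (δ - k * η)) * Real.exp (θ * η) := by
      rw [← Real.exp_add]; congr 1; push_cast; ring
    rw [hexp]
    push_cast
    ring
  obtain ⟨M, hM⟩ := (isCompact_Icc (a := a) (b := a + δ)).exists_bound_of_continuousOn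
    hx.continuousOn
  have hM0 : 0 ≤ M := (norm_nonneg _).trans (hM a ⟨le_rfl, by linarith⟩)
  have huc : UniformContinuousOn x (Set.Icc a (a + δ)) :=
    isCompact_Icc.uniformContinuousOn_of_continuous hx.continuousOn
  set G := Real.exp (|θ| * δ) with hG
  have hG0 : 0 < G := Real.exp_pos _
  rw [tendsto_iff_norm_sub_tendsto_zero]
  refine Metric.tendsto_atTop.2 fun ε hε => ?_
  set ε' := ε / (2 * (G * (|θ| * δ + 1))) with hε'
  have hε'0 : 0 < ε' := by positivity
  obtain ⟨d, hd, hdx⟩ := Metric.uniformContinuousOn_iff.1 huc ε' hε'0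
  have hlim : Tendsto (fun n : ℕ => δ / ((n + 1 : ℕ) : ℝ)) atTop (𝓝 0) :=
    (tendsto_const_div_atTop_nhds_zero_nat δ).comp (tendsto_add_atTop_nat 1)
  have hlim1 : ∀ᶠ n : ℕ in atTop, δ / ((n + 1 : ℕ) : ℝ) < d := hlim.eventually (gt_mem_nhds hd)
  have hlim2 : ∀ᶠ n : ℕ in atTop, |θ * (δ / ((n + 1 : ℕ) : ℝ))| < 1 := by
    have : Tendsto (fun n : ℕ => |θ * (δ / ((n + 1 : ℕ) : ℝ))|) atTop (𝓝 0) := by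
      simpa using (hlim.const_mul θ).abs
    exact this.eventually (gt_mem_nhds one_pos)
  have hlim3 : ∀ᶠ n : ℕ in atTop, G * δ * θ ^ 2 * M * (δ / ((n + 1 : ℕ) : ℝ)) < ε / 2 := by
    have : Tendsto (fun n : ℕ => G * δ * θ ^ 2 * M * (δ / ((n + 1 : ℕ) : ℝ))) atTop (𝓝 0) := by
      simpa using hlim.const_mul (G * δ * θ ^ 2 * M)
    exact this.eventually (gt_mem_nhds (by positivity))
  obtain ⟨n₀, hn₀⟩ := eventually_atTop.1 (hlim1.and (hlim2.and hlim3))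
  refine ⟨n₀, fun n hn => ?_⟩
  obtain ⟨h1, h2, h3⟩ := hn₀ n hn
  rw [herr n, dist_zero_right, norm_norm]
  set η : ℝ := δ / (n + 1 : ℕ) with hη
  have hη0 : 0 ≤ η := by positivity
  have hnη : ((n + 1 : ℕ) : ℝ) * η = δ := by rw [hη]; field_simp
  have hterm : ∀ k ∈ Finset.range (n + 1), ‖Real.exp (-θ * (δ - k * η)) *
      (θ * (∫ u in (a + k * η)..(a + (k + 1 : ℕ) * η), (x u - x (a + (k + 1 : ℕ) * η))) -
        (Real.exp (θ * η) - 1 - θ * η) * x (a + (k + 1 : ℕ) * η))‖ ≤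
      G * (|θ| * (ε' * η) + (θ * η) ^ 2 * M) := by
    intro k hk
    have hk' : ((k + 1 : ℕ) : ℝ) ≤ (n + 1 : ℕ) := by
      exact_mod_cast Nat.succ_le_of_lt (Finset.mem_range.1 hk)
    have hkη : (k + 1 : ℕ) * η ≤ δ := by rw [← hnη]; gcongr
    have hkη' : (k : ℝ) * η ≤ δ := le_trans (by push_cast; nlinarith) hkη
    have hle : a + k * η ≤ a + (k + 1 : ℕ) * η := by push_cast; nlinarith
    have hmem : a + (k + 1 : ℕ) * η ∈ Set.Icc a (a + δ) :=
      ⟨by have : (0 : ℝ) ≤ (k + 1 : ℕ) * η := by positivity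
          linarith, by linarith⟩
    rw [norm_mul]
    refine mul_le_mul ?_ ?_ (norm_nonneg _) hG0.le
    · rw [Real.norm_of_nonneg (Real.exp_pos _).le, hG, Real.exp_le_exp]
      refine (le_abs_self _).trans ?_
      rw [abs_mul, abs_neg]
      refine mul_le_mul_of_nonneg_left ?_ (abs_nonneg _)
      have : 0 ≤ (k : ℝ) * η := by positivity
      rw [abs_of_nonneg (by linarith)]
      linarith
    · refine (norm_sub_le _ _).trans (add_le_add ?_ ?_)
      · rw [norm_mul, Real.norm_eq_abs]
        refine mul_le_mul_of_nonneg_left ?_ (abs_nonneg _)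
        refine (intervalIntegral.norm_integral_le_of_norm_le_const (C := ε')
          fun u hu => ?_).trans_eq ?_
        · rw [Set.uIoc_of_le hle] at hu
          have hu' : u ∈ Set.Icc a (a + δ) :=
            ⟨by have : (0 : ℝ) ≤ k * η := by positivity
                linarith [hu.1], hu.2.trans hmem.2⟩
          refine (hdx u hu' _ hmem ?_).le
          rw [Real.dist_eq, abs_sub_comm, abs_of_nonneg (by linarith [hu.2])]
          have := hu.1
          push_cast at this ⊢
          linarith
        · rw [abs_of_nonneg (by linarith)]
          push_cast
          ring
      · rw [norm_mul]
        exact mul_le_mul (Real.abs_exp_sub_one_sub_id_le h2.le) (hM _ hmem) (norm_nonneg _)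
          (sq_nonneg _)
  refine (norm_sum_le_of_le _ hterm).trans_lt ?_
  rw [Finset.sum_const, Finset.card_range, nsmul_eq_mul]
  have e1 : ((n + 1 : ℕ) : ℝ) * (G * (|θ| * (ε' * η) + (θ * η) ^ 2 * M)) =
      G * (|θ| * δ) * ε' + G * δ * θ ^ 2 * M * η := by
    rw [← hnη]; ring
  have e2 : G * (|θ| * δ) * ε' ≤ ε / 2 := by
    have : G * (|θ| * δ + 1) * ε' = ε / 2 := by
      rw [hε']
      have : G * (|θ| * δ + 1) ≠ 0 := by positivity
      field_simp
    nlinarith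
  rw [e1]
  linarith

end Pathwise

section GaussianLimits

variable {Ω : Type*} [MeasurableSpace Ω] {P : Measure Ω} [IsProbabilityMeasure P]

lemma pi_gaussianReal_eq_map {ι : Type*} [Fintype ι] (v : ℝ≥0) :
    Measure.pi (fun _ : ι => gaussianReal 0 v) =
      (Measure.pi fun _ : ι => gaussianReal 0 1).map fun z i => √v * z i := by
  rw [Measure.pi_map_pi (f := fun (_ : ι) (z : ℝ) => √v * z)
    (fun _ => (measurable_const_mul _).aemeasurable)]
  congr 1
  funext i
  rw [gaussianReal_map_const_mul, mul_zero]
  congr 1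
  ext
  simp

/-- An almost sure limit of centred Gaussian vectors with i.i.d. components is of the same kind. -/
lemma hasLaw_pi_gaussianReal_of_tendsto {ι : Type*} [Fintype ι] {ξn : ℕ → Ω → ι → ℝ}
    {ξ : Ω → ι → ℝ} {v : ℕ → ℝ≥0} {v' : ℝ≥0}
    (hlaw : ∀ n, HasLaw (ξn n) (Measure.pi fun _ => gaussianReal 0 (v n)) P)
    (hv : Tendsto v atTop (𝓝 v'))
    (hξ : ∀ᵐ ω ∂P, Tendsto (fun n => ξn n ω) atTop (𝓝 (ξ ω))) :
    HasLaw ξ (Measure.pi fun _ => gaussianReal 0 v') P := by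
  have hm : AEMeasurable ξ P :=
    aemeasurable_of_tendsto_metrizable_ae _ (fun n => (hlaw n).aemeasurable) hξ
  refine ⟨hm, ?_⟩
  have := Measure.isProbabilityMeasure_map hm
  refine ext_of_forall_integral_eq_of_IsFiniteMeasure fun f => ?_
  have hfm := f.continuous.measurable
  have h1 : Tendsto (fun n => ∫ ω, f (ξn n ω) ∂P) atTop (𝓝 (∫ ω, f (ξ ω) ∂P)) := by
    refine tendsto_integral_of_dominated_convergence (fun _ => ‖f‖)
      (fun n => (hfm.comp_aemeasurable (hlaw n).aemeasurable).aestronglyMeasurable)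
      (integrable_const _) (fun n => ae_of_all _ fun ω => f.norm_coe_le_norm _) ?_
    filter_upwards [hξ] with ω hω
    exact (f.continuous.tendsto _).comp hω
  have hscale : ∀ u : ℝ≥0, ∫ z, f z ∂(Measure.pi fun _ : ι => gaussianReal 0 u) =
      ∫ z, f (fun i => √u * z i) ∂(Measure.pi fun _ : ι => gaussianReal 0 1) := fun u => by
    have hmeas : Measurable fun (z : ι → ℝ) (i : ι) => √u * z i := by fun_prop
    rw [pi_gaussianReal_eq_map u, integral_map hmeas.aemeasurable hfm.aestronglyMeasurable]
  have h2 : Tendsto (fun n => ∫ ω, f (ξn n ω) ∂P) atTop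
      (𝓝 (∫ z, f z ∂(Measure.pi fun _ : ι => gaussianReal 0 v'))) := by
    have : ∀ n, ∫ ω, f (ξn n ω) ∂P =
        ∫ z, f (fun i => √(v n) * z i) ∂(Measure.pi fun _ : ι => gaussianReal 0 1) := fun n => by
      rw [← hscale, ← (hlaw n).map_eq, integral_map (hlaw n).aemeasurable hfm.aestronglyMeasurable]
    simp_rw [this, hscale]
    refine tendsto_integral_of_dominated_convergence (fun _ => ‖f‖)
      (fun n => (hfm.comp (by fun_prop)).aestronglyMeasurable)
      (integrable_const _) (fun n => ae_of_all _ fun ω => f.norm_coe_le_norm _)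
      (ae_of_all _ fun z => ?_)
    refine (f.continuous.tendsto _).comp (tendsto_pi_nhds.2 fun i => ?_)
    exact ((Real.continuous_sqrt.comp NNReal.continuous_coe).tendsto v' |>.comp hv).mul_const _
  rw [integral_map hm hfm.aestronglyMeasurable]
  exact tendsto_nhds_unique h1 h2

/-- Sums of disjoint groups of independent centred Gaussian variables. -/
lemma hasLaw_pi_gaussianReal_sum {ι κ : Type*} [Fintype ι] [Fintype κ] {Δ : ι × κ → Ω → ℝ}
    {η : ℝ≥0} (hind : iIndepFun Δ P) (hΔ : ∀ p, HasLaw (Δ p) (gaussianReal 0 η) P) (c : κ → ℝ) :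
    HasLaw (fun ω i => ∑ k, c k * Δ (i, k) ω)
      (Measure.pi fun _ : ι => gaussianReal 0 (∑ k, ‖c k‖₊ ^ 2 * η)) P := by
  have hG : HasGaussianLaw (fun ω p => Δ p ω) P :=
    hind.hasGaussianLaw fun p => (hΔ p).hasGaussianLaw
  set L : (ι × κ → ℝ) →L[ℝ] (ι → ℝ) := ContinuousLinearMap.pi fun i =>
    ∑ k, c k • ContinuousLinearMap.proj (R := ℝ) (φ := fun _ => ℝ) (i, k) with hL
  have hGξ : HasGaussianLaw (fun ω i => ∑ k, c k * Δ (i, k) ω) P := by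
    refine (hG.map_fun L).congr (ae_of_all _ fun ω => funext fun i => ?_)
    simp [hL]
  have hmem : ∀ p, MemLp (Δ p) 2 P := fun p => (hΔ p).hasGaussianLaw.memLp_two
  have hcovΔ : ∀ p q, p ≠ q → cov[Δ p, Δ q; P] = 0 := fun p q hpq =>
    (hind.indepFun hpq).covariance_eq_zero (hmem p) (hmem q)
  have hcov : ∀ i j, cov[fun ω => ∑ k, c k * Δ (i, k) ω, fun ω => ∑ k, c k * Δ (j, k) ω; P] =
      ∑ k, ∑ l, c k * (c l * cov[Δ (i, k), Δ (j, l); P]) := fun i j => by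
    rw [covariance_fun_sum_fun_sum (fun k => (hmem _).const_mul _) fun k => (hmem _).const_mul _]
    simp_rw [covariance_const_mul_left, covariance_const_mul_right]
  have hindξ : iIndepFun (fun i ω => ∑ k, c k * Δ (i, k) ω) P := by
    refine hGξ.iIndepFun_of_covariance_eq_zero fun i j hij => ?_
    rw [hcov]
    refine Finset.sum_eq_zero fun k _ => Finset.sum_eq_zero fun l _ => ?_
    rw [hcovΔ _ _ (by simp [hij]), mul_zero, mul_zero]
  have hae : ∀ i, AEMeasurable (fun ω => ∑ k, c k * Δ (i, k) ω) P := fun i =>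
    (hGξ.eval i).aemeasurable
  refine ⟨hGξ.aemeasurable, ?_⟩
  rw [(iIndepFun_iff_map_fun_eq_pi_map hae).1 hindξ]
  congr 1
  funext i
  rw [(hGξ.eval i).map_eq_gaussianReal]
  congr 1
  · rw [integral_finsetSum _ fun k _ => ((hmem _).integrable one_le_two).const_mul _]
    refine Finset.sum_eq_zero fun k _ => ?_
    rw [integral_const_mul, (hΔ _).integral_eq, integral_id_gaussianReal, mul_zero]
  · rw [← covariance_self (hae i), hcov]
    have : ∑ k, ∑ l, c k * (c l * cov[Δ (i, k), Δ (i, l); P]) =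
        ((∑ k, ‖c k‖₊ ^ 2 * η : ℝ≥0) : ℝ) := by
      push_cast
      refine Finset.sum_congr rfl fun k _ => ?_
      rw [Finset.sum_eq_single k]
      · rw [covariance_self (hΔ _).aemeasurable, (hΔ _).variance_eq, variance_id_gaussianReal,
          Real.norm_eq_abs, sq_abs]
        ring
      · intro l _ hl
        rw [hcovΔ _ _ (by simp [hl.symm]), mul_zero, mul_zero]
      · simp
    rw [this, Real.toNNReal_coe]

end GaussianLimits

section Innovations

variable {Ω : Type*} [MeasurableSpace Ω] {P : Measure Ω} {W X : ℝ≥0 → Ω → ℝ} {θ σ x₀ : ℝ}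

/-- Scaled Brownian motion solves the Ornstein--Uhlenbeck equation without mean reversion. -/
lemma IsScaledBrownian.isOrnsteinUhlenbeck (hW : IsBrownianReal W P)
    (hX : IsScaledBrownian P W X σ x₀) : IsOrnsteinUhlenbeck P W X 0 σ x₀ := by
  filter_upwards [hX, hW.cont] with ω h1 h2
  refine ⟨?_, fun t => by rw [h1 t]; ring⟩
  simp_rw [h1]
  fun_prop

lemma IsOrnsteinUhlenbeck.ae_eq_zero (hW : IsBrownianReal W P)
    (hX : IsOrnsteinUhlenbeck P W X θ σ x₀) : ∀ᵐ ω ∂P, X 0 ω = x₀ := by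
  filter_upwards [hX, hW.eval_zero_ae_eq_zero] with ω h1 h2
  simpa [h2] using h1.2 0

variable [IsProbabilityMeasure P]

/-- The innovations over disjoint intervals of length `δ` are i.i.d. centred Gaussian variables. -/
lemma IsOrnsteinUhlenbeck.exists_hasLaw_innovations (hW : IsBrownianReal W P) (hσ : 0 < σ)
    (hX : IsOrnsteinUhlenbeck P W X θ σ x₀) {δ : ℝ≥0} (hδ : 0 < δ) (M : ℕ) :
    ∃ v : ℝ≥0, 0 < v ∧
      HasLaw (fun ω (i : Fin M) => X (((i : ℕ) + 1 : ℕ) * δ) ω -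
        Real.exp (-θ * δ) * X ((i : ℕ) * δ) ω) (Measure.pi fun _ => gaussianReal 0 v) P := by
  -- the increments of `W` over the intervals of the partition with mesh `δ / (n + 1)`
  set τ : ℕ → ℕ → ℝ≥0 := fun n p => p * (δ / (n + 1 : ℕ)) with hτ
  set Δ : ∀ n : ℕ, Fin M × Fin (n + 1) → Ω → ℝ := fun n p ω =>
    W (τ n (p.1 * (n + 1) + p.2 + 1)) ω - W (τ n (p.1 * (n + 1) + p.2)) ω with hΔdef
  set c : ∀ n : ℕ, Fin (n + 1) → ℝ := fun n k =>
    σ * Real.exp (-θ * (δ - (k : ℕ) * ((δ : ℝ) / (n + 1 : ℕ)))) with hc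
  set v : ℕ → ℝ≥0 := fun n => ∑ k, ‖c n k‖₊ ^ 2 * (δ / (n + 1 : ℕ)) with hv
  have hmono : ∀ n, Monotone (τ n) := fun n p q hpq => by
    simp only [hτ]; gcongr
  have hind : ∀ n, iIndepFun (Δ n) P := fun n => by
    have h1 := hW.hasIndepIncrements.nat (hmono n)
    refine h1.precomp (g := fun p : Fin M × Fin (n + 1) => (p.1 : ℕ) * (n + 1) + p.2) ?_
    rintro ⟨i, k⟩ ⟨j, l⟩ h
    have h2 : (i : ℕ) * (n + 1) + k = j * (n + 1) + l := h
    have hk := k.2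
    have hl := l.2
    have h3 : (i : ℕ) = j := by
      have e1 : ((i : ℕ) * (n + 1) + k) / (n + 1) = i := by
        rw [mul_comm, Nat.mul_add_div n.succ_pos, Nat.div_eq_of_lt hk, add_zero]
      have e2 : ((j : ℕ) * (n + 1) + l) / (n + 1) = j := by
        rw [mul_comm, Nat.mul_add_div n.succ_pos, Nat.div_eq_of_lt hl, add_zero]
      rw [← e1, h2, e2]
    rw [h3] at h2
    exact Prod.ext (Fin.ext h3) (Fin.ext (by simpa using h2))
  have hΔ : ∀ n p, HasLaw (Δ n p) (gaussianReal 0 (δ / (n + 1 : ℕ))) P := fun n p => by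
    have h1 := hW.hasLaw_sub (τ n (p.1 * (n + 1) + p.2 + 1)) (τ n (p.1 * (n + 1) + p.2))
    have h2 : nndist (τ n (p.1 * (n + 1) + p.2 + 1)).1 (τ n (p.1 * (n + 1) + p.2)).1 =
        δ / (n + 1 : ℕ) := by
      ext
      rw [coe_nndist, Real.dist_eq, NNReal.val_eq_coe, NNReal.val_eq_coe]
      simp only [hτ]
      push_cast
      rw [← sub_mul, add_sub_cancel_left, one_mul, abs_of_nonneg (by positivity)]
    rw [h2] at h1
    exact h1
  have hlaw : ∀ n, HasLaw (fun ω i => ∑ k, c n k * Δ n (i, k) ω)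
      (Measure.pi fun _ : Fin M => gaussianReal 0 (v n)) P := fun n =>
    hasLaw_pi_gaussianReal_sum (hind n) (hΔ n) (c n)
  have hconv : ∀ᵐ ω ∂P, Tendsto (fun (n : ℕ) (i : Fin M) => ∑ k, c n k * Δ n (i, k) ω) atTop
      (𝓝 fun i => X (((i : ℕ) + 1 : ℕ) * δ) ω - Real.exp (-θ * δ) * X ((i : ℕ) * δ) ω) := by
    filter_upwards [hX] with ω hω
    obtain ⟨hcont, heq⟩ := hω
    refine tendsto_pi_nhds.2 fun i => ?_
    have hxc : Continuous fun u : ℝ => X u.toNNReal ω := hcont.comp continuous_real_toNNReal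
    have hh : ∀ s t : ℝ, 0 ≤ s → s ≤ t →
        σ * W t.toNNReal ω - σ * W s.toNNReal ω =
          X t.toNNReal ω - X s.toNNReal ω + θ * ∫ u in s..t, X u.toNNReal ω := by
      intro s t hs hst
      have h1 := heq t.toNNReal
      have h2 := heq s.toNNReal
      rw [Real.coe_toNNReal _ (hs.trans hst)] at h1
      rw [Real.coe_toNNReal _ hs] at h2
      rw [← intervalIntegral.integral_interval_sub_left (hxc.intervalIntegrable _ _)
        (hxc.intervalIntegrable _ _), h1, h2]
      ring
    have hlim := tendsto_sum_exp_mul_increments (x := fun u => X u.toNNReal ω)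
      (h := fun u => σ * W u.toNNReal ω) hxc hh (a := (i : ℕ) * δ) (δ := δ) (by positivity) δ.2
    have e1 : ((i : ℕ) * (δ : ℝ) + δ).toNNReal = (((i : ℕ) + 1 : ℕ) : ℝ≥0) * δ := by
      rw [← Real.toNNReal_coe (r := (((i : ℕ) + 1 : ℕ) : ℝ≥0) * δ)]
      congr 1
      push_cast
      ring
    have e2 : ((i : ℕ) * (δ : ℝ)).toNNReal = ((i : ℕ) : ℝ≥0) * δ := by
      rw [← Real.toNNReal_coe (r := ((i : ℕ) : ℝ≥0) * δ)]
      congr 1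
    simp only [e1, e2] at hlim
    refine hlim.congr fun n => ?_
    rw [← Fin.sum_univ_eq_sum_range (fun k => Real.exp (-θ * (δ - k * ((δ : ℝ) / (n + 1 : ℕ)))) *
        (σ * W ((i : ℕ) * (δ : ℝ) + (k + 1 : ℕ) * ((δ : ℝ) / (n + 1 : ℕ))).toNNReal ω -
          σ * W ((i : ℕ) * (δ : ℝ) + k * ((δ : ℝ) / (n + 1 : ℕ))).toNNReal ω)) (n + 1)]
    have hpt : ∀ k : ℕ, ((i : ℕ) * (δ : ℝ) + k * ((δ : ℝ) / (n + 1 : ℕ))).toNNReal =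
        τ n (i * (n + 1) + k) := fun k => by
      rw [← Real.toNNReal_coe (r := τ n (i * (n + 1) + k))]
      congr 1
      simp only [hτ]
      push_cast
      field_simp
    refine Finset.sum_congr rfl fun k _ => ?_
    rw [hpt, hpt, ← add_assoc]
    simp only [hc, hΔdef]
    ring
  -- the variances stay in a compact interval that does not contain `0`
  set lo : ℝ := σ ^ 2 * Real.exp (-(2 * (|θ| * δ))) * δ with hlo
  set hi : ℝ := σ ^ 2 * Real.exp (2 * (|θ| * δ)) * δ with hhi
  have hδ' : (0 : ℝ) < δ := by exact_mod_cast hδ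
  have hsumδ : ∀ (n : ℕ) (b : ℝ), ∑ _k : Fin (n + 1), b * ((δ : ℝ) / (n + 1 : ℕ)) = b * δ := by
    intro n b
    rw [Finset.sum_const, Finset.card_univ, Fintype.card_fin, nsmul_eq_mul]
    field_simp
  have hck : ∀ n k, ((‖c n k‖₊ ^ 2 : ℝ≥0) : ℝ) =
      σ ^ 2 * Real.exp (2 * (-θ * (δ - (k : ℕ) * ((δ : ℝ) / (n + 1 : ℕ))))) := fun n k => by
    push_cast
    rw [Real.norm_eq_abs, sq_abs, hc, mul_pow, ← Real.exp_nat_mul]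
    push_cast
    rfl
  have hexp : ∀ n (k : Fin (n + 1)),
      |-θ * (δ - (k : ℕ) * ((δ : ℝ) / (n + 1 : ℕ)))| ≤ |θ| * δ := fun n k => by
    rw [abs_mul, abs_neg]
    refine mul_le_mul_of_nonneg_left ?_ (abs_nonneg _)
    have h1 : ((k : ℕ) : ℝ) * ((δ : ℝ) / (n + 1 : ℕ)) ≤ δ := by
      rw [← mul_div_assoc, div_le_iff₀ (by positivity), mul_comm]
      have : ((k : ℕ) : ℝ) ≤ (n + 1 : ℕ) := by exact_mod_cast k.2.le
      gcongr
    have h2 : 0 ≤ ((k : ℕ) : ℝ) * ((δ : ℝ) / (n + 1 : ℕ)) := by positivity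
    rw [abs_of_nonneg (by linarith)]
    linarith
  have hvmem : ∀ n, v n ∈ Set.Icc lo.toNNReal hi.toNNReal := fun n => by
    have hvn : ((v n : ℝ≥0) : ℝ) = ∑ k : Fin (n + 1),
        σ ^ 2 * Real.exp (2 * (-θ * (δ - (k : ℕ) * ((δ : ℝ) / (n + 1 : ℕ))))) *
          ((δ : ℝ) / (n + 1 : ℕ)) := by
      simp only [hv, NNReal.coe_sum, NNReal.coe_mul, hck]
      push_cast
      rfl
    constructor
    · rw [Real.toNNReal_le_iff_le_coe, hvn, hlo, ← hsumδ n]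
      refine Finset.sum_le_sum fun k _ => ?_
      have := (abs_le.1 (hexp n k)).1
      gcongr
      linarith
    · refine NNReal.le_toNNReal_of_coe_le ?_
      rw [hvn, hhi, ← hsumδ n]
      refine Finset.sum_le_sum fun k _ => ?_
      have := (abs_le.1 (hexp n k)).2
      gcongr
  obtain ⟨v', hv', φ, hφ, hlimv⟩ := isCompact_Icc.tendsto_subseq hvmem
  refine ⟨v', lt_of_lt_of_le (Real.toNNReal_pos.2 (by positivity)) hv'.1, ?_⟩
  refine hasLaw_pi_gaussianReal_of_tendsto (fun n => hlaw (φ n)) hlimv ?_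
  filter_upwards [hconv] with ω hω
  exact hω.comp hφ.tendsto_atTop

end Innovations

/-! ### Gaussian autoregressions and their bridges -/

section Autoregression

variable {Ω : Type*} [MeasurableSpace Ω] {P : Measure Ω}

/-- `Z 0, …, Z N` is a Gaussian autoregression `Z (i + 1) = a Z i + ξ i` with deterministic starting
point `x₀` and i.i.d. innovations `ξ i` of law `N(0, v)`. -/
structure IsAutoregression (P : Measure Ω) (Z : ℕ → Ω → ℝ) (a x₀ : ℝ) (v : ℝ≥0) (N : ℕ) : Prop where
  start : ∀ᵐ ω ∂P, Z 0 ω = x₀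
  hasLaw : HasLaw (fun ω (i : Fin N) => Z (i + 1) ω - a * Z i ω)
    (Measure.pi fun _ => gaussianReal 0 v) P

variable {Z : ℕ → Ω → ℝ} {a x₀ : ℝ} {v : ℝ≥0} {N : ℕ}

instance isGaussian_pi_gaussianReal {ι : Type*} [Fintype ι] (v : ℝ≥0) :
    IsGaussian (Measure.pi fun _ : ι => gaussianReal 0 v) := by
  have h1 : iIndepFun (fun (i : ι) (z : ι → ℝ) => z i)
      (Measure.pi fun _ : ι => gaussianReal 0 v) :=
    iIndepFun_pi (X := fun _ z => z) fun _ => aemeasurable_id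
  have h2 := h1.hasGaussianLaw fun i => by
    have : HasLaw (fun z : ι → ℝ => z i) (gaussianReal 0 v)
        (Measure.pi fun _ : ι => gaussianReal 0 v) :=
      (measurePreserving_eval (fun _ : ι => gaussianReal 0 v) i).hasLaw
    exact this.hasGaussianLaw
  have h3 := h2.isGaussian_map
  rwa [Measure.map_id'] at h3

lemma HasGaussianLaw.add_const {E : Type*} [NormedAddCommGroup E] [NormedSpace ℝ E]
    [MeasurableSpace E] [BorelSpace E] [SecondCountableTopology E] [CompleteSpace E] {X : Ω → E}
    (hX : HasGaussianLaw X P) (c : E) : HasGaussianLaw (fun ω => X ω + c) P where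
  isGaussian_map := by
    have := hX.isGaussian_map
    have h : P.map (fun ω => X ω + c) = (P.map X).map (fun x => x + c) := by
      rw [AEMeasurable.map_map_of_aemeasurable (by fun_prop) hX.aemeasurable]
      rfl
    rw [h]
    infer_instance

lemma IsAutoregression.hasGaussianLaw (h : IsAutoregression P Z a x₀ v N) :
    HasGaussianLaw (fun ω (j : Fin (N + 1)) => Z j ω) P := by
  have hrep : ∀ᵐ ω ∂P, ∀ j, j ≤ N → Z j ω =
      (∑ l : Fin N, (if (l : ℕ) < j then a ^ (j - 1 - l) else 0) *
        (Z (l + 1) ω - a * Z l ω)) + a ^ j * x₀ := by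
    filter_upwards [h.start] with ω hω j
    induction j with
    | zero => intro _; simp [hω]
    | succ j ih =>
      intro hj
      have h1 : ∀ l : Fin N, (if (l : ℕ) < j + 1 then a ^ (j + 1 - 1 - l) else 0) *
          (Z (l + 1) ω - a * Z l ω) = a * ((if (l : ℕ) < j then a ^ (j - 1 - l) else 0) *
          (Z (l + 1) ω - a * Z l ω)) + if l = ⟨j, hj⟩ then Z (l + 1) ω - a * Z l ω else 0 := by
        intro l
        rcases lt_trichotomy (l : ℕ) j with hl | hl | hl
        · have h2 : l ≠ ⟨j, hj⟩ := fun h => by simp [h] at hl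
          have h3 : j + 1 - 1 - (l : ℕ) = (j - 1 - l) + 1 := by omega
          rw [if_pos (by omega), if_pos hl, if_neg h2, h3, pow_succ]
          ring
        · have h2 : l = ⟨j, hj⟩ := Fin.ext hl
          simp [h2]
        · have h2 : l ≠ ⟨j, hj⟩ := fun h => by simp [h] at hl
          rw [if_neg (by omega), if_neg (by omega), if_neg h2]
          ring
      simp_rw [h1]
      rw [Finset.sum_add_distrib, ← Finset.mul_sum, Finset.sum_ite_eq' Finset.univ,
        if_pos (Finset.mem_univ _)]
      have := ih (by omega)
      rw [pow_succ]
      linear_combination a * this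
  set c : Fin (N + 1) → Fin N → ℝ := fun j l =>
    if (l : ℕ) < j then a ^ ((j : ℕ) - 1 - l) else 0 with hc
  set L : (Fin N → ℝ) →L[ℝ] (Fin (N + 1) → ℝ) := ContinuousLinearMap.pi fun j =>
    ∑ l : Fin N, c j l • ContinuousLinearMap.proj (R := ℝ) (φ := fun _ => ℝ) l with hL
  have hξ : HasGaussianLaw (fun ω (i : Fin N) => Z (i + 1) ω - a * Z i ω) P :=
    h.hasLaw.hasGaussianLaw
  refine (HasGaussianLaw.add_const (hξ.map_fun L) fun j => a ^ (j : ℕ) * x₀).congr ?_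
  filter_upwards [hrep] with ω hω
  funext j
  simp only [hL, ContinuousLinearMap.coe_pi', sum_apply, smul_apply,
    ContinuousLinearMap.proj_apply, smul_eq_mul]
  exact (hω j (by omega)).symm

lemma IsAutoregression.memLp (h : IsAutoregression P Z a x₀ v N) {j : ℕ} (hj : j ≤ N) :
    MemLp (Z j) 2 P :=
  (h.hasGaussianLaw.eval (⟨j, by omega⟩ : Fin (N + 1))).memLp_two

variable [IsProbabilityMeasure P]

lemma IsAutoregression.covariance_zero (h : IsAutoregression P Z a x₀ v N) (Y : Ω → ℝ) :
    cov[Z 0, Y; P] = 0 := by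
  have : cov[Z 0, Y; P] = cov[fun _ => x₀, Y; P] := by
    unfold covariance
    have h1 : P[Z 0] = x₀ := by rw [integral_congr_ae h.start]; simp
    refine integral_congr_ae ?_
    filter_upwards [h.start] with ω hω
    simp [h1, hω]
  rw [this, covariance_const_left]

lemma IsAutoregression.covariance_innovation (h : IsAutoregression P Z a x₀ v N) {i j : ℕ}
    (hi : i < N) (hj : j < N) :
    cov[fun ω => Z (i + 1) ω - a * Z i ω, fun ω => Z (j + 1) ω - a * Z j ω; P] =
      if i = j then (v : ℝ) else 0 := by
  set ξ : Fin N → Ω → ℝ := fun i ω => Z (i + 1) ω - a * Z i ω with hξ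
  have hG : HasGaussianLaw (fun ω i => ξ i ω) P := h.hasLaw.hasGaussianLaw
  have hmap : ∀ i, P.map (ξ i) = gaussianReal 0 v := fun i => by
    have h1 : P.map (ξ i) = (P.map fun ω i => ξ i ω).map (Function.eval i) := by
      rw [AEMeasurable.map_map_of_aemeasurable (measurable_pi_apply i).aemeasurable
        hG.aemeasurable]
      rfl
    rw [h1, h.hasLaw.map_eq, Measure.pi_map_eval]
    simp
  have hind : iIndepFun ξ P := by
    rw [iIndepFun_iff_map_fun_eq_pi_map fun i => (hG.eval i).aemeasurable]
    simp_rw [hmap]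
    exact h.hasLaw.map_eq
  change cov[ξ ⟨i, hi⟩, ξ ⟨j, hj⟩; P] = _
  split_ifs with hij
  · subst hij
    rw [covariance_self (hG.eval _).aemeasurable,
      (HasLaw.mk (hG.eval _).aemeasurable (hmap _)).variance_eq, variance_id_gaussianReal]
  · exact (hind.indepFun (by simpa using hij)).covariance_eq_zero (hG.eval _).memLp_two
      (hG.eval _).memLp_two

lemma IsAutoregression.covariance_innovation_left (h : IsAutoregression P Z a x₀ v N) {i j : ℕ}
    (hi : i < N) (hj : j ≤ N) :
    cov[fun ω => Z (i + 1) ω - a * Z i ω, Z j; P] =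
      if i < j then a ^ (j - 1 - i) * (v : ℝ) else 0 := by
  have hξ : ∀ {i}, i < N → MemLp (fun ω => Z (i + 1) ω - a * Z i ω) 2 P := fun hi =>
    (h.memLp hi).sub ((h.memLp (by omega)).const_mul a)
  induction j with
  | zero => rw [covariance_comm, h.covariance_zero]; simp
  | succ j ih =>
    have h1 : Z (j + 1) = (fun ω => a * Z j ω) + fun ω => Z (j + 1) ω - a * Z j ω := by
      funext ω; simp
    rw [h1, covariance_add_right (hξ hi) ((h.memLp (by omega)).const_mul a) (hξ (by omega)),
      covariance_const_mul_right, ih (by omega), h.covariance_innovation hi (by omega)]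
    rcases lt_trichotomy i j with hl | hl | hl
    · rw [if_pos hl, if_neg (by omega), if_pos (by omega),
        show j + 1 - 1 - i = (j - 1 - i) + 1 by omega, pow_succ]
      ring
    · subst hl; simp
    · rw [if_neg (by omega), if_neg (by omega), if_neg (by omega)]; ring

lemma IsAutoregression.covariance_succ_sub (h : IsAutoregression P Z a x₀ v N) {i j : ℕ}
    (hi : i < N) (hj : j ≤ N) :
    cov[Z (i + 1), Z j; P] - a * cov[Z i, Z j; P] =
      if i < j then a ^ (j - 1 - i) * (v : ℝ) else 0 := by
  rw [← h.covariance_innovation_left hi hj, covariance_fun_sub_left (h.memLp hi)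
    ((h.memLp (by omega)).const_mul a) (h.memLp hj), covariance_const_mul_left]

/-- The residuals of the regression of `Z (i + 1)` on its two neighbours are uncorrelated with all
other values. -/
lemma IsAutoregression.covariance_neighbours (h : IsAutoregression P Z a x₀ v N) {i j : ℕ}
    (hi : i + 1 < N) (hj : j ≤ N) (hij : j ≠ i + 1) :
    cov[Z (i + 1), Z j; P] =
      a / (1 + a ^ 2) * (cov[Z i, Z j; P] + cov[Z (i + 2), Z j; P]) := by
  have h1 := h.covariance_succ_sub (i := i) (by omega) hj
  have h2 := h.covariance_succ_sub hi hj
  have h3 : (if i < j then a ^ (j - 1 - i) * (v : ℝ) else 0) =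
      a * if i + 1 < j then a ^ (j - 1 - (i + 1)) * (v : ℝ) else 0 := by
    by_cases hlt : i < j
    · rw [if_pos hlt, if_pos (by omega), show j - 1 - i = (j - 1 - (i + 1)) + 1 by omega, pow_succ]
      ring
    · rw [if_neg hlt, if_neg (by omega), mul_zero]
  rw [h3, ← h2] at h1
  have : 1 + a ^ 2 ≠ 0 := by positivity
  rw [div_mul_eq_mul_div, eq_div_iff this]
  linear_combination h1

lemma IsAutoregression.covariance_self_pos (h : IsAutoregression P Z a x₀ v N) (hv : 0 < v)
    (hN : 0 < N) : 0 < cov[Z N, Z N; P] := by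
  obtain ⟨m, rfl⟩ : ∃ m, N = m + 1 := ⟨N - 1, by omega⟩
  have h1 := h.covariance_succ_sub (i := m) (j := m + 1) (by omega) le_rfl
  have h2 := h.covariance_succ_sub (i := m) (j := m) (by omega) (by omega)
  rw [if_pos (by omega), show m + 1 - 1 - m = 0 by omega, pow_zero, one_mul] at h1
  rw [if_neg (by omega)] at h2
  have h3 : 0 ≤ cov[Z m, Z m; P] := by
    rw [covariance_self (h.memLp (by omega)).aestronglyMeasurable.aemeasurable]
    exact variance_nonneg _ _
  rw [covariance_comm (Z m) (Z (m + 1))] at h1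
  have hv' : (0 : ℝ) < v := by exact_mod_cast hv
  have : cov[Z (m + 1), Z (m + 1); P] = a ^ 2 * cov[Z m, Z m; P] + v := by
    linear_combination h1 + a * h2
  rw [this]
  positivity

end Autoregression

section Bridge

variable {Ω : Type*} [MeasurableSpace Ω] (P : Measure Ω) (Z : ℕ → Ω → ℝ)

/-- The regression coefficient of `Z k` on `Z N`. -/
noncomputable def regCoeff (N k : ℕ) : ℝ := cov[Z k, Z N; P] / cov[Z N, Z N; P]

/-- The part of `Z k` that is uncorrelated with `Z N`. -/
noncomputable def pinned (N k : ℕ) (ω : Ω) : ℝ := Z k ω - regCoeff P Z N k * Z N ω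

/-- The law of `Z 1, …, Z m`, pinned to the value `y` at time `m + 1`. -/
noncomputable def bridgeKernel (m : ℕ) : Kernel ℝ (Fin m → ℝ) :=
  (Kernel.id ×ₖ Kernel.const ℝ (P.map fun ω (j : Fin m) => pinned P Z (m + 1) (j + 1) ω)).map
    fun z j => z.2 j + regCoeff P Z (m + 1) (j + 1) * z.1

variable {P Z} {a x₀ : ℝ} {v : ℝ≥0} {m : ℕ}

lemma bridgeKernel_apply [SFinite P] (y : ℝ) : bridgeKernel P Z m y =
    (P.map fun ω (j : Fin m) => pinned P Z (m + 1) (j + 1) ω).map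
      fun (u : Fin m → ℝ) (j : Fin m) => u j + regCoeff P Z (m + 1) (j + 1) * y := by
  have h1 : Measurable fun (z : ℝ × (Fin m → ℝ)) (j : Fin m) =>
      z.2 j + regCoeff P Z (m + 1) (j + 1) * z.1 := by fun_prop
  rw [bridgeKernel, Kernel.map_apply _ h1, Kernel.prod_apply, Kernel.id_apply, Kernel.const_apply,
    Measure.dirac_prod, Measure.map_map h1 (by fun_prop)]
  rfl

variable (hZ : IsAutoregression P Z a x₀ v (m + 1))
include hZ

lemma IsAutoregression.hasGaussianLaw_pinned :
    HasGaussianLaw (fun ω => (fun (j : Fin m) => pinned P Z (m + 1) (j + 1) ω,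
      fun (_ : Unit) => Z (m + 1) ω)) P := by
  set L : (Fin (m + 1 + 1) → ℝ) →L[ℝ] (Fin m → ℝ) × (Unit → ℝ) :=
    (ContinuousLinearMap.pi fun j : Fin m =>
      ContinuousLinearMap.proj (R := ℝ) (φ := fun _ => ℝ) (⟨j + 1, by omega⟩ : Fin (m + 1 + 1)) -
        regCoeff P Z (m + 1) (j + 1) •
          ContinuousLinearMap.proj (R := ℝ) (φ := fun _ => ℝ) (Fin.last (m + 1))).prod
      (ContinuousLinearMap.pi fun _ =>
        ContinuousLinearMap.proj (R := ℝ) (φ := fun _ => ℝ) (Fin.last (m + 1))) with hL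
  refine (hZ.hasGaussianLaw.map_fun L).congr (ae_of_all _ fun ω => ?_)
  refine Prod.ext (funext fun j => ?_) (funext fun _ => ?_)
  · simp [hL, pinned]
  · simp [hL]

lemma IsAutoregression.memLp_pinned {k : ℕ} (hk : k ≤ m + 1) :
    MemLp (pinned P Z (m + 1) k) 2 P :=
  (hZ.memLp hk).sub ((hZ.memLp le_rfl).const_mul _)

variable [IsProbabilityMeasure P]

lemma IsAutoregression.covariance_pinned_left {k : ℕ} (hk : k ≤ m + 1) {Y : Ω → ℝ}
    (hY : MemLp Y 2 P) : cov[pinned P Z (m + 1) k, Y; P] =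
      cov[Z k, Y; P] - regCoeff P Z (m + 1) k * cov[Z (m + 1), Y; P] := by
  unfold pinned
  rw [covariance_fun_sub_left (hZ.memLp hk) ((hZ.memLp le_rfl).const_mul _) hY,
    covariance_const_mul_left]

lemma IsAutoregression.covariance_pinned_end (hv : 0 < v) {k : ℕ} (hk : k ≤ m + 1) :
    cov[pinned P Z (m + 1) k, Z (m + 1); P] = 0 := by
  rw [hZ.covariance_pinned_left hk (hZ.memLp le_rfl), regCoeff,
    div_mul_cancel₀ _ (hZ.covariance_self_pos hv (by omega)).ne', sub_self]

lemma IsAutoregression.covariance_pinned (hv : 0 < v) {k l : ℕ} (hk : k ≤ m + 1)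
    (hl : l ≤ m + 1) : cov[pinned P Z (m + 1) k, pinned P Z (m + 1) l; P] =
      cov[Z k, Z l; P] - regCoeff P Z (m + 1) l * cov[Z k, Z (m + 1); P] := by
  rw [hZ.covariance_pinned_left hk (hZ.memLp_pinned hl),
    covariance_comm (Z (m + 1)) (pinned P Z (m + 1) l), hZ.covariance_pinned_end hv hl, mul_zero,
    sub_zero, covariance_comm, hZ.covariance_pinned_left hl (hZ.memLp hk),
    covariance_comm (Z l), covariance_comm (Z (m + 1))]

lemma IsAutoregression.isMarkovKernel_bridgeKernel : IsMarkovKernel (bridgeKernel P Z m) := by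
  have : IsProbabilityMeasure (P.map fun ω (j : Fin m) => pinned P Z (m + 1) (j + 1) ω) :=
    Measure.isProbabilityMeasure_map hZ.hasGaussianLaw_pinned.fst.aemeasurable
  exact Kernel.IsMarkovKernel.map _ (by fun_prop)

lemma IsAutoregression.hasCondDistrib_bridgeKernel (hv : 0 < v) :
    HasCondDistrib (fun ω (j : Fin m) => Z (j + 1) ω) (Z (m + 1)) (bridgeKernel P Z m) P := by
  have hM := hZ.isMarkovKernel_bridgeKernel
  have hG := hZ.hasGaussianLaw_pinned
  set V : Ω → Fin m → ℝ := fun ω j => pinned P Z (m + 1) (j + 1) ω with hV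
  have hVm : AEMeasurable V P := hG.fst.aemeasurable
  have hEm : AEMeasurable (Z (m + 1)) P := (hZ.memLp le_rfl).aestronglyMeasurable.aemeasurable
  have hind : IndepFun (Z (m + 1)) V P := by
    have h1 := HasGaussianLaw.indepFun_of_covariance_eval
      (X := fun (j : Fin m) => pinned P Z (m + 1) (j + 1)) (Y := fun (_ : Unit) => Z (m + 1)) hG
      fun j _ => hZ.covariance_pinned_end hv (by omega)
    exact (h1.comp (φ := fun x => x) (ψ := fun f : Unit → ℝ => f ()) measurable_id
      (by fun_prop)).symm
  set Φ : ℝ × (Fin m → ℝ) → ℝ × (Fin m → ℝ) := fun z =>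
    (z.1, fun j => z.2 j + regCoeff P Z (m + 1) (j + 1) * z.1) with hΦ
  have hΦm : Measurable Φ := by fun_prop
  have hpair : (fun ω => (Z (m + 1) ω, fun j : Fin m => Z (j + 1) ω)) =
      Φ ∘ fun ω => (Z (m + 1) ω, V ω) := by
    funext ω
    simp [hΦ, hV, pinned]
  refine ⟨?_, ?_⟩
  · rw [hpair]
    exact hΦm.comp_aemeasurable (hEm.prodMk hVm)
  · have hprobE := Measure.isProbabilityMeasure_map (μ := P) hEm
    have hprobV := Measure.isProbabilityMeasure_map (μ := P) hVm
    rw [hpair, ← AEMeasurable.map_map_of_aemeasurable hΦm.aemeasurable (hEm.prodMk hVm),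
      (indepFun_iff_map_prod_eq_prod_map_map hEm hVm).1 hind]
    ext s hs
    rw [Measure.map_apply hΦm hs, Measure.prod_apply (hΦm hs), Measure.compProd_apply hs]
    refine lintegral_congr fun y => ?_
    rw [bridgeKernel_apply, Measure.map_apply (by fun_prop) (measurable_prodMk_left hs)]
    rfl

lemma IsAutoregression.continuous_bridgeKernel [IsMarkovKernel (bridgeKernel P Z m)] :
    Continuous (kernelLaw (bridgeKernel P Z m)) := by
  have hVm : AEMeasurable (fun ω (j : Fin m) => pinned P Z (m + 1) (j + 1) ω) P :=
    hZ.hasGaussianLaw_pinned.fst.aemeasurable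
  have := Measure.isProbabilityMeasure_map (μ := P) hVm
  refine continuous_iff_continuousAt.2 fun y =>
    ProbabilityMeasure.tendsto_iff_forall_integral_tendsto.2 fun f => ?_
  have hfm := f.continuous.measurable
  have heq : ∀ y, ∫ x, f x ∂(kernelLaw (bridgeKernel P Z m) y : Measure (Fin m → ℝ)) =
      ∫ u, f (fun j => u j + regCoeff P Z (m + 1) (j + 1) * y)
        ∂(P.map fun ω (j : Fin m) => pinned P Z (m + 1) (j + 1) ω) := fun y => by
    change ∫ x, f x ∂(bridgeKernel P Z m y) = _
    have hmeas : Measurable fun (u : Fin m → ℝ) (j : Fin m) =>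
      u j + regCoeff P Z (m + 1) (j + 1) * y := by fun_prop
    rw [bridgeKernel_apply, integral_map hmeas.aemeasurable hfm.aestronglyMeasurable]
  simp_rw [heq]
  refine Continuous.tendsto (continuous_of_dominated (bound := fun _ => ‖f‖)
    (fun y => (hfm.comp (by fun_prop)).aestronglyMeasurable)
    (fun y => ae_of_all _ fun u => f.norm_coe_le_norm _) (integrable_const _)
    (ae_of_all _ fun u => ?_)) y
  exact f.continuous.comp (by fun_prop)

/-- The law of the end point has full support, so that a continuous version of the bridge is
unique. -/
lemma IsAutoregression.eq_bridgeKernel (hv : 0 < v) {κ : Kernel ℝ (Fin m → ℝ)} [IsMarkovKernel κ]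
    (hκ : HasCondDistrib (fun ω (j : Fin m) => Z (j + 1) ω) (Z (m + 1)) κ P)
    (hκc : Continuous (kernelLaw κ)) (y : ℝ) : κ y = bridgeKernel P Z m y := by
  have hM := hZ.isMarkovKernel_bridgeKernel
  have hprob := Measure.isProbabilityMeasure_map (μ := P) hκ.aemeasurable_fst
  have hG : HasGaussianLaw (Z (m + 1)) P := hZ.hasGaussianLaw.eval (Fin.last (m + 1))
  have h1 : κ =ᵐ[P.map (Z (m + 1))] bridgeKernel P Z m :=
    Kernel.ae_eq_of_compProd_eq (hκ.map_eq.symm.trans (hZ.hasCondDistrib_bridgeKernel hv).map_eq)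
  have hvar : Var[Z (m + 1); P].toNNReal ≠ 0 := by
    rw [← covariance_self hG.aemeasurable]
    exact (Real.toNNReal_pos.2 (hZ.covariance_self_pos hv (by omega))).ne'
  rw [hG.map_eq_gaussianReal] at h1
  have h2 := (gaussianReal_absolutelyContinuous' P[Z (m + 1)] hvar).ae_le h1
  have h3 : kernelLaw κ =ᵐ[volume] kernelLaw (bridgeKernel P Z m) := by
    filter_upwards [h2] with y hy
    exact Subtype.ext hy
  have h4 := (hκc.ae_eq_iff_eq volume hZ.continuous_bridgeKernel).1 h3
  exact congrArg Subtype.val (congrFun h4 y)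

lemma IsAutoregression.hasLinearCondMeans_bridgeKernel (hv : 0 < v) (y : ℝ) :
    HasLinearCondMeans (bridgeKernel P Z m y) (neighbourMatrix m (a / (1 + a ^ 2))) := by
  set U : Ω → Fin m → ℝ := fun ω j =>
    pinned P Z (m + 1) (j + 1) ω + regCoeff P Z (m + 1) (j + 1) * y with hU
  have hGU : HasGaussianLaw U P :=
    HasGaussianLaw.add_const hZ.hasGaussianLaw_pinned.fst fun j => regCoeff P Z (m + 1) (j + 1) * y
  have hlaw : bridgeKernel P Z m y = P.map U := by
    rw [bridgeKernel_apply, AEMeasurable.map_map_of_aemeasurable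
      (Measurable.aemeasurable (by fun_prop)) hZ.hasGaussianLaw_pinned.fst.aemeasurable]
    rfl
  refine ⟨⟨?_⟩, fun i l hli => ?_⟩
  · rw [hlaw, Measure.map_id']
    exact hGU.isGaussian_map
  have hUmem : ∀ j, MemLp (fun ω => U ω j) 2 P := fun j => (hGU.eval j).memLp_two
  have hcovU : ∀ j, cov[fun ω => U ω j, fun ω => U ω l; P] =
      cov[pinned P Z (m + 1) (j + 1), pinned P Z (m + 1) (l + 1); P] := fun j => by
    have hint : ∀ j : Fin m, Integrable (pinned P Z (m + 1) (j + 1)) P := fun j =>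
      (hZ.memLp_pinned (by omega)).integrable one_le_two
    simp only [hU]
    rw [covariance_add_const_left (hint j), covariance_add_const_right (hint l)]
  set f : ℕ → ℝ := fun k => cov[pinned P Z (m + 1) k, pinned P Z (m + 1) (l + 1); P] with hf
  have hfk : ∀ k, k ≤ m + 1 → f k = cov[Z k, Z (l + 1); P] -
      regCoeff P Z (m + 1) (l + 1) * cov[Z k, Z (m + 1); P] := fun k hk =>
    hZ.covariance_pinned hv hk (by omega)
  have hf0 : f 0 = 0 := by
    rw [hfk 0 (by omega), hZ.covariance_zero, hZ.covariance_zero, mul_zero, sub_zero]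
  have hfN : f (m + 1) = 0 := by
    rw [hfk _ le_rfl, regCoeff, div_mul_cancel₀ _ (hZ.covariance_self_pos hv (by omega)).ne',
      covariance_comm, sub_self]
  rw [hlaw, covariance_map]
  · change cov[fun ω => U ω i - ∑ j, neighbourMatrix m (a / (1 + a ^ 2)) i j * U ω j,
      fun ω => U ω l; P] = 0
    rw [covariance_fun_sub_left (hUmem i)
      (memLp_finsetSum _ fun j _ => (hUmem j).const_mul _) (hUmem l),
      covariance_fun_sum_left (fun j => (hUmem j).const_mul _) (hUmem l)]
    simp_rw [covariance_const_mul_left, hcovU]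
    rw [sum_neighbourMatrix_mul _ hf0 hfN i]
    change f (i + 1) - _ = 0
    have hi := i.2
    have hl := l.2
    have hne : (l : ℕ) ≠ i := fun h => hli (Fin.ext h)
    rw [hfk _ (by omega), hfk _ (by omega), hfk _ (by omega),
      hZ.covariance_neighbours (i := i) (j := l + 1) (by omega) (by omega) (by omega),
      hZ.covariance_neighbours (i := i) (j := m + 1) (by omega) le_rfl (by omega)]
    ring
  · exact Measurable.aestronglyMeasurable (by unfold residual; fun_prop)
  · exact Measurable.aestronglyMeasurable (by fun_prop)
  · exact hGU.aemeasurable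

end Bridge

/-! ### Relaxation time of the bridge samplers -/

section Anchors

variable {Ω : Type*} [MeasurableSpace Ω] {P : Measure Ω} [IsProbabilityMeasure P]
  {W X : ℝ≥0 → Ω → ℝ} {θ σ x₀ : ℝ} {T : ℝ≥0}

/-- Observed at the anchors and at the two end points, the diffusion is an autoregression. -/
lemma IsOrnsteinUhlenbeck.exists_isAutoregression (hW : IsBrownianReal W P) (hσ : 0 < σ)
    (hX : IsOrnsteinUhlenbeck P W X θ σ x₀) (hT : 0 < T) (m : ℕ) :
    ∃ (Z : ℕ → Ω → ℝ) (a : ℝ) (v : ℝ≥0), 0 < a ∧ 0 < v ∧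
      IsAutoregression P Z a x₀ v (m + 1) ∧ Z (m + 1) = X T ∧
      ∀ i : Fin m, Z (i + 1) = X (anchor T m i) := by
  set δ : ℝ≥0 := T / ((m : ℝ≥0) + 1) with hδ
  have hδ0 : 0 < δ := by positivity
  obtain ⟨v, hv, hlaw⟩ := hX.exists_hasLaw_innovations hW hσ hδ0 (m + 1)
  refine ⟨fun j => X (j * δ), Real.exp (-θ * δ), v, Real.exp_pos _, hv, ⟨?_, hlaw⟩, ?_, fun i => ?_⟩
  · simpa using hX.ae_eq_zero hW
  · have : ((m + 1 : ℕ) : ℝ≥0) * δ = T := by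
      rw [hδ]; push_cast; field_simp
    simp only [this]
  · have : ((i + 1 : ℕ) : ℝ≥0) * δ = anchor T m i := by
      rw [hδ, anchor]; push_cast; rw [mul_div_assoc]
    simp only [this]

lemma IsOrnsteinUhlenbeck.exists_isBridgeKnotLaw (hW : IsBrownianReal W P) (hσ : 0 < σ)
    (hX : IsOrnsteinUhlenbeck P W X θ σ x₀) (hT : 0 < T) (m : ℕ) :
    ∃ (κ : Kernel ℝ (Fin m → ℝ)) (_ : IsMarkovKernel κ), IsBridgeKnotLaw P X T m κ := by
  obtain ⟨Z, a, v, -, hv, hZ, hend, hknot⟩ := hX.exists_isAutoregression hW hσ hT m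
  have hM := hZ.isMarkovKernel_bridgeKernel
  refine ⟨bridgeKernel P Z m, hM, ?_, hZ.continuous_bridgeKernel⟩
  have h := hZ.hasCondDistrib_bridgeKernel hv
  simp_rw [hknot, hend] at h
  exact h

lemma IsOrnsteinUhlenbeck.exists_hasLinearCondMeans (hW : IsBrownianReal W P) (hσ : 0 < σ)
    (hX : IsOrnsteinUhlenbeck P W X θ σ x₀) (hT : 0 < T) {m : ℕ} {κ : Kernel ℝ (Fin m → ℝ)}
    [IsMarkovKernel κ] (hκ : IsBridgeKnotLaw P X T m κ) :
    ∃ β : ℝ, 0 ≤ β ∧ β ≤ 1 / 2 ∧ ∀ y, HasLinearCondMeans (κ y) (neighbourMatrix m β) := by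
  obtain ⟨Z, a, v, ha, hv, hZ, hend, hknot⟩ := hX.exists_isAutoregression hW hσ hT m
  refine ⟨a / (1 + a ^ 2), by positivity, ?_, fun y => ?_⟩
  · rw [div_le_div_iff₀ (by positivity) two_pos]
    nlinarith [sq_nonneg (a - 1)]
  · have h := hκ.hasCondDistrib
    simp_rw [← hknot, ← hend] at h
    rw [hZ.eq_bridgeKernel hv h hκ.continuous y]
    exact hZ.hasLinearCondMeans_bridgeKernel hv y

end Anchors

end BlockedSampler

open BlockedSampler

theorem theorem3 {Ω : Type*} [MeasurableSpace Ω] (P : Measure Ω) [IsProbabilityMeasure P]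
    (W X : ℝ≥0 → Ω → ℝ) (hW : IsBrownianReal W P)
    (θ σ x₀ : ℝ) (hσ : 0 < σ)
    (T : ℕ → ℝ≥0) (hT : ∀ m, 0 < T m)
    -- scaled Brownian motion, or Ornstein--Uhlenbeck with `T = o(m)`
    (hX : IsScaledBrownian P W X σ x₀ ∨
      (IsOrnsteinUhlenbeck P W X θ σ x₀ ∧
        (fun m => (T m : ℝ)) =o[atTop] fun m : ℕ => (m : ℝ)))
    (S : ∀ m, BlockingScheme m)
    (hS : ∀ m, 2 ≤ m → (S m).IsCheckerboard ∨ (S m).IsLexicographic ∨ (S m).IsRandom) :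
    -- the bridges exist
    (∀ m, ∃ (κ : Kernel ℝ (Fin m → ℝ)) (_ : IsMarkovKernel κ), IsBridgeKnotLaw P X (T m) m κ) ∧
    ∀ (κ : ∀ m, Kernel ℝ (Fin m → ℝ)) [∀ m, IsMarkovKernel (κ m)],
      (∀ m, IsBridgeKnotLaw P X (T m) m (κ m)) →
      ∀ xT : ℕ → ℝ,
        -- the convergence rate is well defined and smaller than one
        (∀ m, 2 ≤ m →
          IsLeast (l2Rates (κ m (xT m)) ((S m).sweep (κ m (xT m))))
            (l2ConvergenceRate (κ m (xT m)) ((S m).sweep (κ m (xT m)))) ∧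
          l2ConvergenceRate (κ m (xT m)) ((S m).sweep (κ m (xT m))) < 1) ∧
        (fun m => relaxationTime (κ m (xT m)) ((S m).sweep (κ m (xT m)))) =O[atTop]
          fun m : ℕ => (m : ℝ) ^ 2 := by
  obtain ⟨θ', hX'⟩ : ∃ θ', IsOrnsteinUhlenbeck P W X θ' σ x₀ := by
    rcases hX with hX | ⟨hX, -⟩
    · exact ⟨0, hX.isOrnsteinUhlenbeck hW⟩
    · exact ⟨θ, hX⟩
  refine ⟨fun m => hX'.exists_isBridgeKnotLaw hW hσ (hT m) m, fun κ _ hκ xT => ?_⟩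
  have hmem : ∀ m, 2 ≤ m → √(1 - 2 / ((m : ℝ) + 1) ^ 2) ∈
      l2Rates (κ m (xT m)) ((S m).sweep (κ m (xT m))) := fun m hm => by
    obtain ⟨β, hβ0, hβ, h⟩ := hX'.exists_hasLinearCondMeans hW hσ (hT m) (hκ m)
    exact sqrt_mem_l2Rates (by omega) (hS m hm) hβ0 hβ (h (xT m))
  have hsqrt : ∀ m : ℕ, 2 ≤ m →
      √(1 - 2 / ((m : ℝ) + 1) ^ 2) ≤ 1 - 1 / ((m : ℝ) + 1) ^ 2 := fun m hm => by
    have hm' : (2 : ℝ) ≤ m := by exact_mod_cast hm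
    refine (sqrt_one_sub_le ?_).trans_eq (by ring)
    rw [div_le_one (by positivity)]
    nlinarith
  have hlt : ∀ m : ℕ, 2 ≤ m → √(1 - 2 / ((m : ℝ) + 1) ^ 2) < 1 := fun m hm => by
    have : 0 < 1 / ((m : ℝ) + 1) ^ 2 := by positivity
    linarith [hsqrt m hm]
  refine ⟨fun m hm => ?_, ?_⟩
  · have hL := isLeast_l2ConvergenceRate ⟨_, hmem m hm⟩
    exact ⟨hL, (hL.2 (hmem m hm)).trans_lt (hlt m hm)⟩
  · refine IsBigO.of_bound 4 ?_
    filter_upwards [eventually_ge_atTop 2] with m hm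
    have hm' : (2 : ℝ) ≤ m := by exact_mod_cast hm
    rw [Real.norm_eq_abs, Real.norm_of_nonneg (by positivity)]
    calc |relaxationTime (κ m (xT m)) ((S m).sweep (κ m (xT m)))|
        ≤ (1 - √(1 - 2 / ((m : ℝ) + 1) ^ 2))⁻¹ := relaxationTime_le_of_mem (hmem m hm) (hlt m hm)
      _ ≤ (1 / ((m : ℝ) + 1) ^ 2)⁻¹ := inv_anti₀ (by positivity) (by linarith [hsqrt m hm])
      _ = ((m : ℝ) + 1) ^ 2 := by rw [one_div, inv_inv]
      _ ≤ 4 * (m : ℝ) ^ 2 := by nlinarith
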